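/- **Conventions.** Algebraic languages may have any number of operation symbols, all of positive arity (a constant is treated as a unary operation with a constant value), and algebras are non-empty. A *logic* $\vdash$ is a substitution-invariant (not necessarily finitary) consequence relation on the set $Fm(\vdash)$ of formulas of a language $\mathscr{L}_\vdash$ over some infinite set of variables; a *theorem* is a formula $\varphi$ with $\emptyset\vdash\varphi$. A *matrix* is a pair $\langle A,F\rangle$ with $A$ an algebra and $F\subseteq A$. It is a *model* of $\vdash$ (and $F$ is a *filter* of $\vdash$ on $A$) if $A$ is an $\mathscr{L}_\vdash$-algebra and, whenever $\Gamma\vdash\varphi$, every homomorphism $h\colon Fm(\vdash)\to A$ with $h[\Gamma]\subseteq F$ satisfies $h(\varphi)\in F$; $\mathsf{Mod}(\vdash)$ is the class of all models. The *Leibniz congruence* $\Omega^{A}F$ is the largest congruence $\theta$ of $A$ compatible with $F$ (i.e. $a\in F$ and $\langle a,b\rangle\in\theta$ imply $b\in F$). $\mathsf{Mod}^{\equiv}(\vdash)$ is the class of models $\langle A,F\rangle$ of $\vdash$ for which the intersection of all $\Omega^{A}G$, with $G\supseteq F$ a filter of $\vdash$ on $A$, is the identity relation. A *translation* $\tau$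 of $\mathscr{L}$ into $\mathscr{L}'$ sends each $n$-ary symbol $f$ of $\mathscr{L}$ to a formula $\tau(f)$ of $\mathscr{L}'$ in the variables $x_1,\dots,x_n$; for an $\mathscr{L}'$-algebra $A$, the $\mathscr{L}$-algebra $A^{\tau}$ has the universe of $A$ and interprets $f$ as $\tau(f)^{A}$. We write ${\vdash}\le{\vdash'}$ if there is a translation $\tau$ of $\mathscr{L}_\vdash$ into $\mathscr{L}_{\vdash'}$ such that $\langle A^{\tau},F\rangle\in\mathsf{Mod}^{\equiv}(\vdash)$ for all $\langle A,F\rangle\in\mathsf{Mod}^{\equiv}(\vdash')$. A class $\mathsf{K}$ of logics is a *Leibniz class* if there are logics $\vdash_\alpha$, for $\alpha$ an ordinal, such that ${\vdash_\beta}\le{\vdash_\alpha}$ whenever $\alpha\le\beta$, and $\mathsf{K}=\{{\vdash} : {\vdash_\alpha}\le{\vdash}\text{ for some ordinal }\alpha\}$. Leibniz classes are ordered by inclusion, and $\mathsf{K}\vee\mathsf{K}'$ is the supremum of $\mathsf{K},\mathsf{K}'$ in this order. Let $\mathsf{Proto}$ (resp. $\mathsf{Equiv}$) be the class of *protoalgebraic*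 (resp. *equivalential*) logics, i.e. those $\vdash$ with a non-empty set of formulas $\Delta(x,y,\vec z)$ (resp. $\Delta(x,y)$, without parameters) such that for all $\langle A,F\rangle\in\mathsf{Mod}(\vdash)$ and $a,b\in A$: $\langle a,b\rangle\in\Omega^{A}F$ if and only if $\Delta^{A}(a,b,\vec c)\subseteq F$ for all $\vec c\in A$ (resp. $\Delta^{A}(a,b)\subseteq F$). Let $\mathsf{Asrt}$ be the class of *assertional* logics, i.e. those $\vdash$ such that $F$ is a singleton for every $\langle A,F\rangle\in\mathsf{Mod}^{\equiv}(\vdash)$. Let $\mathsf{Injctv}$ be the class of logics $\vdash$ with an *injective theorem*, i.e. a theorem $\varphi(x)$ in one variable such that $\varphi^{A}\colon A\to A$ is injective for every $\langle A,F\rangle\in\mathsf{Mod}^{\equiv}(\vdash)$. A Leibniz class $\mathsf{K}$ is *meet-reducible among logics with theorems* if $\mathsf{K}=\mathsf{K}_1\cap\mathsf{K}_2$ for some Leibniz classes $\mathsf{K}_1,\mathsf{K}_2$, both different from $\mathsf{K}$, all of whose members are logics with theorems. **Theorem.** $\mathsf{Equiv}$, $\mathsf{Proto}\cap\mathsf{Injctv}$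 and $\mathsf{Proto}\cap\mathsf{Asrt}$ are Leibniz classes, and the suprema $\mathsf{Equiv}\vee(\mathsf{Proto}\cap\mathsf{Injctv})$ and $\mathsf{Equiv}\vee(\mathsf{Proto}\cap\mathsf{Asrt})$ exist among the Leibniz classes. The Leibniz class $\mathsf{Equiv}$ is meet-reducible among logics with theorems, and $$\mathsf{Equiv}=\bigl(\mathsf{Equiv}\vee(\mathsf{Proto}\cap\mathsf{Injctv})\bigr)\cap\bigl(\mathsf{Equiv}\vee(\mathsf{Proto}\cap\mathsf{Asrt})\bigr).$$ -/

import Mathlib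

universe u

namespace AAL

/-- A (propositional) logic: a substitution invariant consequence relation, not necessarily
finitary, on the formulas of an algebraic language over an infinite set of variables.
Languages may have any number of operation symbols, all of them of positive arity: a constant
is regarded as a unary operation that takes a constant value. -/
structure Logic : Type (u + 1) where
  lang : FirstOrder.Language.{u, 0}
  [algebraic : lang.IsAlgebraic]
  [noConstants : IsEmpty (lang.Functions 0)]
  Var : Type u
  [infinite : Infinite Var]
  Entails : Set (lang.Term Var) → lang.Term Var → Prop
  refl : ∀ (Γ : Set (lang.Term Var)) (φ : lang.Term Var), φ ∈ Γ → Entails Γ φ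
  cut : ∀ (Γ Δ : Set (lang.Term Var)) (φ : lang.Term Var),
    (∀ ψ ∈ Δ, Entails Γ ψ) → Entails Δ φ → Entails Γ φ
  subst : ∀ (σ : Var → lang.Term Var) (Γ : Set (lang.Term Var)) (φ : lang.Term Var),
    Entails Γ φ → Entails ((fun ψ => ψ.subst σ) '' Γ) (φ.subst σ)

attribute [instance] Logic.algebraic Logic.noConstants Logic.infinite

/-- A logical matrix `⟨A, F⟩`: a non-empty algebra together with a subset of its universe. -/
structure LogicalMatrix (L : FirstOrder.Language.{u, 0}) : Type (u + 1) where
  carrier : Type u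
  [nonempty : Nonempty carrier]
  [str : L.Structure carrier]
  filter : Set carrier

attribute [instance] LogicalMatrix.nonempty LogicalMatrix.str

/-- `θ` is a congruence of the algebra `A`. -/
def IsCongruence (L : FirstOrder.Language.{u, 0}) {A : Type u} [L.Structure A]
    (θ : Setoid A) : Prop :=
  ∀ (n : ℕ) (f : L.Functions n) (v w : Fin n → A),
    (∀ i, θ (v i) (w i)) →
      θ (FirstOrder.Language.Structure.funMap f v) (FirstOrder.Language.Structure.funMap f w)

/-- `θ` is compatible with `F`: it never relates a member of `F` to a non-member. -/
def Compatible {A : Type u} (θ : Setoid A) (F : Set A) : Prop :=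
  ∀ a b, θ a b → a ∈ F → b ∈ F

/-- The Leibniz congruence of `F` on `A`, the largest congruence of `A` compatible with `F`,
given as the union of all of them. -/
def LeibnizCongr (L : FirstOrder.Language.{u, 0}) {A : Type u} [L.Structure A]
    (F : Set A) (a b : A) : Prop :=
  ∃ θ : Setoid A, IsCongruence L θ ∧ Compatible θ F ∧ θ a b

namespace Logic

/-- `F` is a deductive filter of the logic `S` on the algebra `A`, that is, `⟨A, F⟩` is a model
of `S`. The valuations `v` are the homomorphisms from the formula algebra to `A`. -/
def IsFilter (S : Logic.{u}) {A : Type u} [S.lang.Structure A] (F : Set A) : Prop :=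
  ∀ (Γ : Set (S.lang.Term S.Var)) (φ : S.lang.Term S.Var), S.Entails Γ φ →
    ∀ v : S.Var → A, (∀ ψ ∈ Γ, ψ.realize v ∈ F) → φ.realize v ∈ F

/-- The class `Mod(S)` of models of `S`. -/
def Mod (S : Logic.{u}) : Set (LogicalMatrix.{u} S.lang) :=
  {M | S.IsFilter M.filter}

/-- The Suszko congruence of `F` relative to `S`: the intersection of the Leibniz congruences of
the deductive filters of `S` that extend `F`. -/
def SuszkoCongr (S : Logic.{u}) {A : Type u} [S.lang.Structure A] (F : Set A) (a b : A) : Prop :=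
  ∀ G : Set A, S.IsFilter G → F ⊆ G → LeibnizCongr S.lang G a b

/-- The class `Mod^≡(S)` of Suszko reduced models of `S`: those whose Suszko congruence is the
identity. -/
def ModEquiv (S : Logic.{u}) : Set (LogicalMatrix.{u} S.lang) :=
  {M | M ∈ S.Mod ∧ ∀ a b : M.carrier, S.SuszkoCongr M.filter a b → a = b}

end Logic

/-- A translation of `L` into `L'` sends each `n`-ary symbol of `L` to an `n`-ary term of `L'`. -/
abbrev Translation (L L' : FirstOrder.Language.{u, 0}) : Type u :=
  ∀ n : ℕ, L.Functions n → L'.Term (Fin n)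

/-- The matrix `⟨A^τ, F⟩`: the symbol `f` is interpreted on `A` as the term function of `τ(f)`.
(The languages of interest have no relation symbols, so the value of `RelMap` is irrelevant.) -/
def LogicalMatrix.translate {L L' : FirstOrder.Language.{u, 0}} (τ : Translation L L')
    (M : LogicalMatrix.{u} L') : LogicalMatrix.{u} L where
  carrier := M.carrier
  str :=
    { funMap := fun {n} f v => (τ n f).realize v
      RelMap := fun {_} _ _ => False }
  filter := M.filter

/-- `S.Interpretable S'` is `S ≤ S'`: there is an interpretation of `S` into `S'`, that is, a
translation `τ` such that `⟨A^τ, F⟩ ∈ Mod^≡(S)` whenever `⟨A, F⟩ ∈ Mod^≡(S')`. -/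
def Logic.Interpretable (S S' : Logic.{u}) : Prop :=
  ∃ τ : Translation S.lang S'.lang, ∀ M ∈ S'.ModEquiv, M.translate τ ∈ S.ModEquiv

/-- A class of logics is a Leibniz class if it is `Log(Φ)` for a Leibniz condition `Φ`, i.e. a
family of logics indexed by all ordinals and decreasing with respect to interpretability. -/
def IsLeibnizClass (K : Set Logic.{u}) : Prop :=
  ∃ Φ : Ordinal.{u} → Logic.{u},
    (∀ α β, α ≤ β → (Φ β).Interpretable (Φ α)) ∧ K = {S | ∃ α, (Φ α).Interpretable S}

/-- The Leibniz hierarchy: all Leibniz classes, ordered by inclusion. -/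
abbrev LeibnizClass : Type (u + 1) := {K : Set Logic.{u} // IsLeibnizClass K}

/-- Logics that have a theorem. -/
def Thrms : Set Logic.{u} := {S | ∃ φ, S.Entails ∅ φ}

/-- Protoalgebraic logics: those with a non-empty set `Δ(x, y, z⃗)` of congruence formulas with
parameters. The variables `x, y` are `Sum.inl 0, Sum.inl 1`; the others are the parameters. -/
def Proto : Set Logic.{u} :=
  {S | ∃ Δ : Set (S.lang.Term (Fin 2 ⊕ S.Var)), Δ.Nonempty ∧
    ∀ M ∈ S.Mod, ∀ a b : M.carrier, LeibnizCongr S.lang M.filter a b ↔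
      ∀ c : S.Var → M.carrier, ∀ δ ∈ Δ, δ.realize (Sum.elim ![a, b] c) ∈ M.filter}

/-- Equivalential logics: those with a non-empty set `Δ(x, y)` of congruence formulas without
parameters. -/
def Equivl : Set Logic.{u} :=
  {S | ∃ Δ : Set (S.lang.Term (Fin 2)), Δ.Nonempty ∧
    ∀ M ∈ S.Mod, ∀ a b : M.carrier, LeibnizCongr S.lang M.filter a b ↔
      ∀ δ ∈ Δ, δ.realize ![a, b] ∈ M.filter}

/-- Assertional logics: `F` is a singleton for every `⟨A, F⟩ ∈ Mod^≡(S)`. -/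
def Asrt : Set Logic.{u} := {S | ∀ M ∈ S.ModEquiv, ∃ a, M.filter = {a}}

/-- The formula `φ(x)` is an injective theorem of `S`: it is a theorem of `S`, and its term
function is injective on every algebra underlying a matrix in `Mod^≡(S)`. -/
def Logic.IsInjectiveTheorem (S : Logic.{u}) (φ : S.lang.Term (Fin 1)) : Prop :=
  (∀ x : S.Var, S.Entails ∅ (φ.relabel fun _ => x)) ∧
    ∀ M ∈ S.ModEquiv, Function.Injective fun a : M.carrier => φ.realize fun _ => a

/-- Logics with an injective theorem. -/
def Injctv : Set Logic.{u} := {S | ∃ φ, S.IsInjectiveTheorem φ}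

/-- A Leibniz class is meet-reducible among logics with theorems if it is the intersection of two
Leibniz classes that comprise only logics with theorems and are both different from it. -/
def MeetReducibleAmongThrms (K : LeibnizClass.{u}) : Prop :=
  ∃ K₁ K₂ : LeibnizClass.{u}, (K₁ : Set Logic.{u}) ⊆ Thrms ∧ (K₂ : Set Logic.{u}) ⊆ Thrms ∧
    (K : Set Logic.{u}) = (K₁ : Set Logic.{u}) ∩ (K₂ : Set Logic.{u}) ∧ K ≠ K₁ ∧ K ≠ K₂

end AAL

/-! Everything rests on reading a logic through its Suszko reduced models. A logic is equivalential
iff parameter-free terms define equality in these models (`mem_equivl_iff`), and protoalgebraic iff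
parameter-free terms there satisfy reflexivity and modus ponens (`mem_proto_iff`). Such descriptions
survive interpretations, so the classes are upward closed. Each is also generated by logics defined
by all matrices that satisfy the description, with an index set for the symbols. A logic in the
class may need arbitrarily many witnessing terms, so the index set grows with the ordinal; once it
is large enough, its symbols can be mapped onto those terms.

Suprema come from products. The product logic has families of terms as operations and interprets
into both factors by projection. If both factors have theorems, a reduced model of the product
splits into reduced models of the factors (`exists_factors`): the operations `merge` mix components,
and the value `e` of a theorem serves as a base point, so that the elements whose other component is
that of `e` form a factor. Hence the product is a greatest lower bound for interpretability, and the
products of the levels of two Leibniz conditions define the supremum of the classes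
(`exists_isLUB_pair`).

For the intersection, the product of an equivalential logic with one having an injective theorem
yields a theorem `c(x)` and terms `E(x,y)` such that `E(a,b)` designated and `c(a) = c(b)` force `a
= b`. The product with an assertional logic yields reflexive terms `E'(x,y)` that separate
designated elements. A logic above both products has congruence formulas `E(x,y) ∪ E'(c(x),c(y))`,
since values of `c` are designated (`equivl_of_prodLogic_interpretable`).

Neither supremum collapses to `Equivl`, because two explicit protoalgebraic logics, one assertional
and one with an injective theorem, are not equivalential: in each, two elements are told apart only
by a parameter missing from a submatrix. -/

namespace AAL

open FirstOrder.Language FirstOrder.Language.Structure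

variable {L : FirstOrder.Language.{u, 0}}

/-! ### Terms, homomorphisms and supports -/

/-- The value of `t` depends only on the variables in `U`. -/
def SupportedOn {W : Type*} (t : L.Term W) (U : Set W) : Prop :=
  ∀ (A : Type u) [L.Structure A] (v w : W → A), Set.EqOn v w U → t.realize v = t.realize w

/-- Finiteness of terms lets polynomials with parameters in an arbitrary algebra be renamed into the
fixed variables of a logic. -/
theorem exists_finite_support {W : Type*} (t : L.Term W) :
    ∃ U : Set W, U.Finite ∧ SupportedOn t U := by
  induction t with
  | var x => exact ⟨{x}, Set.finite_singleton x, fun A _ v w h => h rfl⟩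
  | func f ts ih =>
    choose U hU hs using ih
    refine ⟨⋃ i, U i, Set.finite_iUnion hU, fun A _ v w h => ?_⟩
    simp only [Term.realize_func]
    congr 1
    funext i
    exact hs i A v w (h.mono (Set.subset_iUnion U i))

/-- `h` is a homomorphism of algebras. -/
def IsHom (L : FirstOrder.Language.{u, 0}) {A B : Type*} [L.Structure A] [L.Structure B]
    (h : A → B) : Prop :=
  ∀ (n : ℕ) (f : L.Functions n) (v : Fin n → A), h (funMap f v) = funMap f (h ∘ v)

theorem IsHom.realize {A B : Type*} [L.Structure A] [L.Structure B] {h : A → B}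
    (hh : IsHom L h) {W : Type*} (t : L.Term W) (v : W → A) :
    h (t.realize v) = t.realize (h ∘ v) := by
  induction t with
  | var x => rfl
  | func f ts ih =>
    simp only [Term.realize_func, hh _ f]
    congr 1
    funext i
    exact ih i

/-- The algebra of terms. -/
instance termStructure (L : FirstOrder.Language.{u, 0}) [L.IsAlgebraic] (W : Type*) :
    L.Structure (L.Term W) where
  funMap f ts := Term.func f ts

theorem isHom_realize [L.IsAlgebraic] {A W : Type*} [L.Structure A] (v : W → A) :
    IsHom L fun t : L.Term W => t.realize v := by
  intro n f ts
  rfl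

theorem realize_termStructure [L.IsAlgebraic] {W X : Type*} (t : L.Term X)
    (σ : X → L.Term W) :
    t.realize σ = t.subst σ := by
  induction t with
  | var x => rfl
  | func f ts ih =>
    simp only [Term.realize_func, Term.subst]
    change Term.func f _ = _
    congr 1
    funext i
    exact ih i

/-! ### The Leibniz congruence -/

/-- Two elements are related when no polynomial function together with `F` separates them. -/
theorem isCongruence_polynomial {A : Type u} [L.Structure A] (F : Set A) :
    ∃ θ : Setoid A, IsCongruence L θ ∧ Compatible θ F ∧ ∀ a b, θ a b ↔
      ∀ t : L.Term (Option A), t.realize (fun o => o.elim a id) ∈ F ↔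
        t.realize (fun o => o.elim b id) ∈ F := by
  classical
  let r : A → A → Prop := fun a b =>
    ∀ t : L.Term (Option A), t.realize (fun o => o.elim a id) ∈ F ↔
      t.realize (fun o => o.elim b id) ∈ F
  have hr : Equivalence r :=
    ⟨fun _ _ => Iff.rfl, fun h t => (h t).symm, fun h h' t => (h t).trans (h' t)⟩
  refine ⟨⟨r, hr⟩, ?_, ?_, fun _ _ => Iff.rfl⟩
  · intro n f v w h
    -- The arguments `v i` are exchanged for `w i` one index at a time; at index `j` the basic
    -- operation with its other arguments frozen is absorbed into the polynomial.
    have key : ∀ s : Finset (Fin n), ∀ t : L.Term (Option A),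
        t.realize (fun o => o.elim (funMap f v) id) ∈ F ↔
          t.realize (fun o => o.elim (funMap f (s.piecewise w v)) id) ∈ F := by
      intro s
      induction s using Finset.induction_on with
      | empty => simp
      | insert j s hj ih =>
        intro t
        rw [ih t]
        have := h j (t.subst fun o => o.elim
          (Term.func f fun i => if i = j then Term.var none
            else Term.var (some (s.piecewise w v i))) fun c => Term.var (some c))
        rw [Term.realize_subst, Term.realize_subst] at this
        convert this using 3
        · funext o
          cases o with
          | some c => rfl
          | none =>
            simp only [Option.elim, Term.realize_func]
            congr 1
            funext i
            by_cases hi : i = j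
            · subst hi; simp [hj]
            · simp [hi]
        · funext o
          cases o with
          | some c => rfl
          | none =>
            simp only [Option.elim, Term.realize_func]
            congr 1
            funext i
            by_cases hi : i = j
            · subst hi; simp
            · simp [hi, Finset.piecewise]
    intro t
    simpa using key Finset.univ t
  · intro a b h ha
    exact (h (Term.var none)).1 ha

theorem IsCongruence.realize {A : Type u} [L.Structure A] {θ : Setoid A} (hθ : IsCongruence L θ)
    {W : Type*} (t : L.Term W) {v w : W → A} (h : ∀ x, θ (v x) (w x)) :
    θ (t.realize v) (t.realize w) := by
  induction t with
  | var x => exact h x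
  | func f ts ih => exact hθ _ f _ _ ih

/-- Polynomial indiscernibility is itself a compatible congruence, and every compatible congruence
is preserved by polynomials. -/
theorem leibnizCongr_iff {A : Type u} [L.Structure A] {F : Set A} {a b : A} :
    LeibnizCongr L F a b ↔ ∀ t : L.Term (Option A), t.realize (fun o => o.elim a id) ∈ F ↔
        t.realize (fun o => o.elim b id) ∈ F := by
  constructor
  · rintro ⟨θ, hθ, hF, hab⟩ t
    have : θ (t.realize fun o => o.elim a id) (t.realize fun o => o.elim b id) := by
      apply hθ.realize
      rintro (_ | c)
      · exact hab
      · exact θ.refl _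
    exact ⟨hF _ _ this, hF _ _ (θ.symm this)⟩
  · intro h
    obtain ⟨θ, hθ, hF, h'⟩ := isCongruence_polynomial (L := L) F
    exact ⟨θ, hθ, hF, (h' a b).2 h⟩

/-- The Leibniz congruence is the largest compatible congruence. -/
theorem exists_leibniz_setoid {A : Type u} [L.Structure A] (F : Set A) :
    ∃ θ : Setoid A, IsCongruence L θ ∧ Compatible θ F ∧ ∀ a b, θ a b ↔ LeibnizCongr L F a b := by
  obtain ⟨θ, hθ, hF, h'⟩ := isCongruence_polynomial (L := L) F
  exact ⟨θ, hθ, hF, fun a b => (h' a b).trans leibnizCongr_iff.symm⟩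

theorem LeibnizCongr.refl {A : Type u} [L.Structure A] (F : Set A) (a : A) :
    LeibnizCongr L F a a :=
  leibnizCongr_iff.2 fun _ => Iff.rfl

theorem LeibnizCongr.mem_iff {A : Type u} [L.Structure A] {F : Set A} {a b : A}
    (h : LeibnizCongr L F a b) : a ∈ F ↔ b ∈ F :=
  leibnizCongr_iff.1 h (Term.var none)

theorem LeibnizCongr.realize {A : Type u} [L.Structure A] {F : Set A} {W : Type*} (t : L.Term W)
    {v w : W → A} (h : ∀ x, LeibnizCongr L F (v x) (w x)) :
    LeibnizCongr L F (t.realize v) (t.realize w) := by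
  obtain ⟨θ, hθ, -, h'⟩ := exists_leibniz_setoid (L := L) F
  exact (h' _ _).1 (hθ.realize t fun x => (h' _ _).2 (h x))

/-- Surjective homomorphisms preserve the Leibniz congruence of a preimage. -/
theorem LeibnizCongr.map {A B : Type u} [L.Structure A] [L.Structure B] {h : A → B}
    (hh : IsHom L h) (hs : Function.Surjective h) {G : Set B} {a b : A}
    (hab : LeibnizCongr L (h ⁻¹' G) a b) : LeibnizCongr L G (h a) (h b) := by
  rw [leibnizCongr_iff] at hab ⊢
  intro t
  -- Surjectivity supplies preimages for the parameters of the polynomial.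
  have key : ∀ c, h ((t.relabel (Option.map (Function.surjInv hs))).realize
      (fun o => o.elim c id)) = t.realize (fun o => o.elim (h c) id) := by
    intro c
    rw [hh.realize, Term.realize_relabel]
    congr 1
    funext o
    cases o with
    | none => rfl
    | some d => exact Function.surjInv_eq hs d
  have := hab (t.relabel (Option.map (Function.surjInv hs)))
  simpa only [Set.mem_preimage, key] using this

/-- Homomorphisms reflect the Leibniz congruence into that of the preimage. -/
theorem LeibnizCongr.comap {A B : Type u} [L.Structure A] [L.Structure B] {h : A → B}
    (hh : IsHom L h) {G : Set B} {a b : A}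
    (hab : LeibnizCongr L G (h a) (h b)) : LeibnizCongr L (h ⁻¹' G) a b := by
  rw [leibnizCongr_iff (L := L)]
  intro t
  simp only [Set.mem_preimage, hh.realize]
  apply LeibnizCongr.mem_iff (L := L)
  apply LeibnizCongr.realize
  rintro (_ | c)
  · exact hab
  · exact LeibnizCongr.refl G (h c)

/-! ### Filters and reduced models -/

namespace Logic

variable (S : Logic.{u})

theorem IsFilter.preimage {S : Logic.{u}} {A B : Type u} [S.lang.Structure A]
    [S.lang.Structure B] {h : A → B} (hh : IsHom S.lang h) {G : Set B} (hG : S.IsFilter G) :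
    S.IsFilter (h ⁻¹' G) := by
  intro Γ φ hφ v hv
  simp only [Set.mem_preimage, hh.realize] at hv ⊢
  exact hG Γ φ hφ _ hv

/-- The filter of `M` is one of the filters intersected over, so the Suszko congruence lies below
the Leibniz congruence. -/
theorem mem_modEquiv_of_leibniz {S : Logic.{u}} {M : LogicalMatrix S.lang} (hM : M ∈ S.Mod)
    (h : ∀ a b, LeibnizCongr S.lang M.filter a b → a = b) : M ∈ S.ModEquiv :=
  ⟨hM, fun a b hab => h a b (hab M.filter hM subset_rfl)⟩

end Logic

/-- The quotient of the matrix `⟨A, F⟩` by `θ`. -/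
noncomputable def quotientMatrix (L : FirstOrder.Language.{u, 0}) [L.IsAlgebraic] {A : Type u}
    [Nonempty A] [L.Structure A] (θ : Setoid A) (F : Set A) : LogicalMatrix L where
  carrier := Quotient θ
  nonempty := ⟨Quotient.mk θ (Classical.arbitrary A)⟩
  str := { funMap := fun f v => Quotient.mk θ (funMap f fun i => (v i).out) }
  filter := {q | q.out ∈ F}

namespace Logic

variable (S : Logic.{u})

/-- Every model has a reduction, which is Suszko reduced. -/
theorem exists_reduction {S : Logic.{u}} {A : Type u} [Nonempty A] [S.lang.Structure A]
    {F : Set A} (hF : S.IsFilter F) :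
    ∃ N ∈ S.ModEquiv, ∃ h : A → N.carrier, Function.Surjective h ∧ IsHom S.lang h ∧
      h ⁻¹' N.filter = F ∧ ∀ a b, h a = h b ↔ LeibnizCongr S.lang F a b := by
  obtain ⟨θ, hθ, hc, h'⟩ := exists_leibniz_setoid (L := S.lang) F
  obtain ⟨N, h, hs, hh, hp, hk⟩ : ∃ N : LogicalMatrix S.lang, ∃ h : A → N.carrier,
      Function.Surjective h ∧ IsHom S.lang h ∧ h ⁻¹' N.filter = F ∧
        ∀ a b, h a = h b ↔ LeibnizCongr S.lang F a b := by
    refine ⟨quotientMatrix S.lang θ F, Quotient.mk θ, Quotient.mk_surjective, ?_, ?_, ?_⟩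
    · exact fun n f v =>
        Quotient.sound (hθ n f _ _ fun i => θ.symm (Quotient.mk_out (v i)))
    · ext a
      exact ⟨hc _ _ (Quotient.mk_out a), hc _ _ (θ.symm (Quotient.mk_out a))⟩
    · exact fun a b => Quotient.eq.trans (h' a b)
  refine ⟨N, mem_modEquiv_of_leibniz ?_ ?_, h, hs, hh, hp, hk⟩
  · intro Γ φ hφ v hv
    obtain ⟨w, rfl⟩ : ∃ w, v = h ∘ w :=
      ⟨fun x => Function.surjInv hs (v x), funext fun x => (Function.surjInv_eq hs _).symm⟩
    have := hF Γ φ hφ w fun ψ hψ => by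
      rw [← hp, Set.mem_preimage, hh.realize]; exact hv ψ hψ
    rw [← hp, Set.mem_preimage, hh.realize] at this
    exact this
  · intro x y hxy
    obtain ⟨a, rfl⟩ := hs x
    obtain ⟨b, rfl⟩ := hs y
    rw [hk, ← hp]
    exact hxy.comap hh

/-- A term that takes designated values in all reduced models does so in all models. -/
theorem IsFilter.realize_mem {S : Logic.{u}} {A : Type u} [Nonempty A] [S.lang.Structure A]
    {F : Set A} (hF : S.IsFilter F) {W : Type*} (t : S.lang.Term W) (v : W → A)
    (ht : ∀ M ∈ S.ModEquiv, ∀ w : W → M.carrier, (∀ x y, v x = v y → w x = w y) →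
      t.realize w ∈ M.filter) : t.realize v ∈ F := by
  obtain ⟨N, hN, h, -, hh, hp, -⟩ := exists_reduction hF
  rw [← hp, Set.mem_preimage, hh.realize]
  exact ht N hN _ fun x y hxy => congrArg h hxy

/-- The set of theorems is a filter of the term algebra. -/
theorem isFilter_theorems :
    S.IsFilter {φ : S.lang.Term S.Var | S.Entails ∅ φ} := by
  intro Γ φ hφ v hv
  simp only [realize_termStructure] at hv ⊢
  refine S.cut _ _ _ ?_ (S.subst v Γ φ hφ)
  rintro _ ⟨ψ, hψ, rfl⟩
  exact hv ψ hψ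

/-- Completeness with respect to reduced models, obtained by reducing the term algebra with the
theorems designated. -/
theorem entails_empty_of_forall {S : Logic.{u}} (φ : S.lang.Term S.Var)
    (h : ∀ M ∈ S.ModEquiv, ∀ v : S.Var → M.carrier, φ.realize v ∈ M.filter) :
    S.Entails ∅ φ := by
  have : Nonempty (S.lang.Term S.Var) := ⟨Term.var (Classical.arbitrary _)⟩
  have := (isFilter_theorems S).realize_mem φ Term.var fun M hM w _ => h M hM w
  rw [realize_termStructure] at this
  have e : φ.subst (Term.var : S.Var → _) = φ := by
    rw [← realize_termStructure]
    clear this h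
    induction φ with
    | var x => rfl
    | func f ts ih => exact congrArg (Term.func f) (funext ih)
  rwa [e] at this

end Logic

variable {L' : FirstOrder.Language.{u, 0}}

/-! ### Translations -/

/-- The translation of a term. -/
def Translation.onTerm (τ : Translation L L') {W : Type*} (t : L.Term W) : L'.Term W :=
  t.substFunc fun {n} f => τ n f

theorem realize_onTerm (τ : Translation L L') (M : LogicalMatrix L') {W : Type*} (t : L.Term W)
    (v : W → M.carrier) :
    (τ.onTerm t).realize v = (t.realize (M := (M.translate τ).carrier) v : M.carrier) := by
  induction t with
  | var x => rfl
  | func f ts ih =>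
    simp only [Translation.onTerm, Term.substFunc, Term.realize_subst] at ih ⊢
    exact congrArg (fun w => (τ _ f).realize w) (funext ih)

theorem LogicalMatrix.translate_translate {L'' : FirstOrder.Language.{u, 0}}
    (τ : Translation L L') (τ' : Translation L' L'') (M : LogicalMatrix L'') :
    (M.translate τ').translate τ = M.translate fun n f => τ'.onTerm (τ n f) := by
  have : ((M.translate τ').translate τ).str =
      (M.translate fun n f => τ'.onTerm (τ n f)).str := by
    refine FirstOrder.Language.Structure.ext ?_ rfl
    funext n f v
    exact (realize_onTerm τ' M (τ n f) v).symm
  exact congrArg (fun s => @LogicalMatrix.mk L M.carrier M.nonempty s M.filter) this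

theorem LogicalMatrix.translate_id [L.IsAlgebraic] (M : LogicalMatrix L) :
    (M.translate fun _ f => Term.func f Term.var) = M := by
  have : (M.translate fun _ f => Term.func f Term.var).str = M.str := by
    refine FirstOrder.Language.Structure.ext rfl ?_
    funext n r
    exact isEmptyElim r
  exact congrArg (fun s => @LogicalMatrix.mk L M.carrier M.nonempty s M.filter) this

namespace Logic

theorem Interpretable.refl (S : Logic.{u}) : S.Interpretable S :=
  ⟨fun _ f => Term.func f Term.var, fun M hM => by rwa [M.translate_id]⟩

theorem Interpretable.trans {S T R : Logic.{u}} (h : S.Interpretable T) (h' : T.Interpretable R) :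
    S.Interpretable R := by
  obtain ⟨τ, hτ⟩ := h
  obtain ⟨τ', hτ'⟩ := h'
  exact ⟨fun n f => τ'.onTerm (τ n f), fun M hM => by
    rw [← LogicalMatrix.translate_translate]; exact hτ _ (hτ' M hM)⟩

end Logic

/-! ### Leibniz classes -/

/-- A class of logics that is closed upwards under interpretability, and in which the members of
a family indexed by the ordinals eventually lie below each member, is a Leibniz class. -/
theorem isLeibnizClass_of_eventually_interpretable {K : Set Logic.{u}}
    (Ψ : Ordinal.{u} → Logic.{u}) (hΨ : ∀ α, Ψ α ∈ K)
    (hup : ∀ S ∈ K, ∀ S', S.Interpretable S' → S' ∈ K)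
    (hK : ∀ S ∈ K, ∃ α, ∀ β ≥ α, (Ψ β).Interpretable S) : IsLeibnizClass K := by
  choose c hc using fun α => hK (Ψ α) (hΨ α)
  -- Reindexing by transfinite recursion makes `Ψ` decreasing: `f β` exceeds the threshold `c (f a)`
  -- of every earlier `a`. Taking the maximum with `β` keeps `f` cofinal.
  obtain ⟨f, hf⟩ : ∃ f : Ordinal.{u} → Ordinal.{u},
      ∀ β, f β = max β (⨆ a : Set.Iio β, c (f a)) := by
    let F : (β : Ordinal.{u}) → ((α : Ordinal.{u}) → α < β → Ordinal.{u}) → Ordinal.{u} :=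
      fun β g => max β (⨆ a : Set.Iio β, c (g a a.2))
    exact ⟨WellFounded.fix wellFounded_lt F, fun β => WellFounded.fix_eq wellFounded_lt F β⟩
  refine ⟨fun α => Ψ (f α), fun α β hαβ => ?_, ?_⟩
  · rcases hαβ.eq_or_lt with rfl | hlt
    · exact Logic.Interpretable.refl _
    · refine hc _ _ ?_
      rw [hf β]
      exact (le_ciSup (f := fun a : Set.Iio β => c (f a)) Ordinal.bddAbove_of_small
        ⟨α, hlt⟩).trans (le_max_right _ _)
  · ext S
    constructor
    · intro hS
      obtain ⟨α, hα⟩ := hK S hS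
      exact ⟨α, hα _ (by rw [hf α]; exact le_max_left _ _)⟩
    · rintro ⟨α, hα⟩
      exact hup _ (hΨ _) _ hα

/-! ### Logics defined by classes of matrices -/

/-- The logic over the variables in `V` that is defined by the class `C` of matrices. -/
abbrev ofClass (L : FirstOrder.Language.{u, 0}) [L.IsAlgebraic] [IsEmpty (L.Functions 0)]
    (V : Type u) [Infinite V] (C : Set (LogicalMatrix.{u} L)) : Logic.{u} where
  lang := L
  Var := V
  Entails Γ φ := ∀ M ∈ C, ∀ v : V → M.carrier,
    (∀ ψ ∈ Γ, ψ.realize v ∈ M.filter) → φ.realize v ∈ M.filter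
  refl Γ φ h M _ v hv := hv φ h
  cut Γ Δ φ h h' M hM v hv := h' M hM v fun ψ hψ => h ψ hψ M hM v hv
  subst σ Γ φ h M hM v hv := by
    rw [Term.realize_subst]
    refine h M hM _ fun ψ hψ => ?_
    rw [← Term.realize_subst]
    exact hv _ ⟨ψ, hψ, rfl⟩

/-- Finitely many variables can be renamed into an infinite set of variables. -/
theorem exists_relabel {W A : Type*} (V : Type*) [Infinite V] [Nonempty A] {U : Set W}
    (hU : U.Finite) (v : W → A) : ∃ (g : W → V) (w : V → A), ∀ x ∈ U, w (g x) = v x := by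
  classical
  have : Finite U := hU
  let e : U ↪ V := (Finite.equivFin U).toEmbedding.trans
    (Fin.valEmbedding.trans (Infinite.natEmbedding V))
  refine ⟨fun x => if h : x ∈ U then e ⟨x, h⟩ else Classical.arbitrary V,
    Function.extend e (fun x => v x) fun _ => Classical.arbitrary A, fun x hx => ?_⟩
  simp only [hx, dif_pos]
  exact e.injective.extend_apply _ _ _

section ofClass

variable [L.IsAlgebraic] [IsEmpty (L.Functions 0)] {V : Type u} [Infinite V]
  {C : Set (LogicalMatrix.{u} L)}

theorem isFilter_ofClass_of_mem {M : LogicalMatrix.{u} L} (hM : M ∈ C) : M ∈ (ofClass L V C).Mod :=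
  fun _ _ h v hv => h M hM v hv

/-- A rule that is valid in `C` preserves the filters of `ofClass L V C`, whatever its variables
are, provided that they can be renamed into `V`. -/
theorem mem_of_isFilter_ofClass {A : Type u} [L.Structure A] {F : Set A}
    (hF : (ofClass L V C).IsFilter F) {W : Type*} {U : Set W} (v : W → A)
    (hg : ∃ (g : W → V) (w : V → A), ∀ x ∈ U, w (g x) = v x)
    (Γ : Set (L.Term W)) (φ : L.Term W) (hΓ : ∀ ψ ∈ Γ, SupportedOn ψ U) (hφ : SupportedOn φ U)
    (h : ∀ M ∈ C, ∀ w : W → M.carrier, (∀ ψ ∈ Γ, ψ.realize w ∈ M.filter) →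
      φ.realize w ∈ M.filter)
    (hv : ∀ ψ ∈ Γ, ψ.realize v ∈ F) : φ.realize v ∈ F := by
  obtain ⟨g, w, hw⟩ := hg
  have := hF (Term.relabel g '' Γ) (φ.relabel g) (fun M hM w' hw' => by
    rw [Term.realize_relabel]
    refine h M hM _ fun ψ hψ => ?_
    rw [← Term.realize_relabel]
    exact hw' _ ⟨ψ, hψ, rfl⟩) w (by
    rintro _ ⟨ψ, hψ, rfl⟩
    rw [Term.realize_relabel, hΓ ψ hψ A (w ∘ g) v hw]
    exact hv ψ hψ)
  rwa [Term.realize_relabel, hφ A (w ∘ g) v hw] at this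

/-- A rule with finitely many variables that is valid in `C` preserves the filters of
`ofClass L V C`. -/
theorem mem_of_isFilter_ofClass_of_finite {A : Type u} [Nonempty A] [L.Structure A] {F : Set A}
    (hF : (ofClass L V C).IsFilter F) {W : Type*} {U : Set W} (hU : U.Finite) (v : W → A)
    (Γ : Set (L.Term W)) (φ : L.Term W) (hΓ : ∀ ψ ∈ Γ, SupportedOn ψ U) (hφ : SupportedOn φ U)
    (h : ∀ M ∈ C, ∀ w : W → M.carrier, (∀ ψ ∈ Γ, ψ.realize w ∈ M.filter) →
      φ.realize w ∈ M.filter)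
    (hv : ∀ ψ ∈ Γ, ψ.realize v ∈ F) : φ.realize v ∈ F :=
  mem_of_isFilter_ofClass hF v (exists_relabel V hU v) Γ φ hΓ hφ h hv

theorem mem_of_isFilter_ofClass_of_finite' {A : Type u} [Nonempty A] [L.Structure A] {F : Set A}
    (hF : (ofClass L V C).IsFilter F) {W : Type*} [Finite W] (v : W → A)
    (Γ : Set (L.Term W)) (φ : L.Term W)
    (h : ∀ M ∈ C, ∀ w : W → M.carrier, (∀ ψ ∈ Γ, ψ.realize w ∈ M.filter) →
      φ.realize w ∈ M.filter)
    (hv : ∀ ψ ∈ Γ, ψ.realize v ∈ F) : φ.realize v ∈ F := by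
  have hs : ∀ ψ : L.Term W, SupportedOn ψ Set.univ := fun ψ A _ v w h => by
    rw [show v = w from funext fun x => h (Set.mem_univ x)]
  exact mem_of_isFilter_ofClass_of_finite hF Set.finite_univ v Γ φ (fun ψ _ => hs ψ) (hs φ) h hv

/-- If designated values of the terms in `Γ` force `s = t` in the matrices in `C`, then they do so
in the Suszko reduced models of the logic defined by `C`. -/
theorem realize_eq_of_mem_modEquiv_ofClass {M : LogicalMatrix.{u} L}
    (hM : M ∈ (ofClass L V C).ModEquiv) {W : Type*} [Finite W] (Γ : Set (L.Term W))
    (s t : L.Term W)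
    (h : ∀ N ∈ C, ∀ w : W → N.carrier, (∀ ψ ∈ Γ, ψ.realize w ∈ N.filter) →
      s.realize w = t.realize w)
    (v : W → M.carrier) (hv : ∀ ψ ∈ Γ, ψ.realize v ∈ M.filter) : s.realize v = t.realize v := by
  refine hM.2 _ _ fun G hG hMG => leibnizCongr_iff.2 fun p => ?_
  have key : ∀ s t : L.Term W,
      (∀ N ∈ C, ∀ w : W → N.carrier, (∀ ψ ∈ Γ, ψ.realize w ∈ N.filter) →
        s.realize w = t.realize w) →
      p.realize (fun o => o.elim (s.realize v) id) ∈ G →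
      p.realize (fun o => o.elim (t.realize v) id) ∈ G := by
    intro s t h hs
    obtain ⟨U, hU, hp⟩ := exists_finite_support p
    -- Turning the parameters of `p` into variables makes "from `Γ` and `p(s)` infer `p(t)`" a rule
    -- valid in `C`. Its variables lie in the finite set `X`, so it preserves the filter `G`.
    let inst (r : L.Term W) : L.Term (W ⊕ M.carrier) :=
      p.subst fun o => o.elim (r.relabel Sum.inl) fun c => Term.var (Sum.inr c)
    have hinst : ∀ (r : L.Term W) (A : Type u) [L.Structure A] (w : W ⊕ M.carrier → A),
        (inst r).realize w =
          p.realize (fun o => o.elim (r.realize (w ∘ Sum.inl)) (w ∘ Sum.inr)) := by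
      intro r A _ w
      rw [Term.realize_subst]
      congr 1
      funext o
      cases o with
      | none => exact Term.realize_relabel
      | some c => rfl
    let X : Set (W ⊕ M.carrier) := Set.range Sum.inl ∪ Sum.inr '' (some ⁻¹' U)
    have hX : X.Finite := (Set.finite_range _).union
      ((hU.preimage (Option.some_injective _).injOn).image _)
    have hsupp : ∀ r, SupportedOn (inst r) X := by
      intro r A _ w w' hw
      rw [hinst, hinst]
      apply hp
      have e : w ∘ Sum.inl = w' ∘ Sum.inl := funext fun x => hw (Or.inl ⟨x, rfl⟩)
      rintro (_ | c) hc
      · simp [e]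
      · exact hw (Or.inr ⟨c, hc, rfl⟩)
    have := mem_of_isFilter_ofClass_of_finite hG hX (Sum.elim v id)
      (insert (inst s) (Term.relabel Sum.inl '' Γ)) (inst t) ?_ (hsupp t) ?_ ?_
    · rwa [hinst] at this
    · rintro ψ (rfl | ⟨ψ, -, rfl⟩)
      · exact hsupp s
      · intro A _ w w' hw
        rw [Term.realize_relabel, Term.realize_relabel]
        congr 1
        exact funext fun x => hw (Or.inl ⟨x, rfl⟩)
    · intro N hN w hw
      rw [hinst, ← h N hN (w ∘ Sum.inl), ← hinst]
      · exact hw _ (Set.mem_insert _ _)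
      · intro ψ hψ
        rw [← Term.realize_relabel]
        exact hw _ (Set.mem_insert_of_mem _ ⟨ψ, hψ, rfl⟩)
    · rintro ψ (rfl | ⟨ψ, hψ, rfl⟩)
      · rw [hinst]
        exact hs
      · rw [Term.realize_relabel]
        exact hMG (hv ψ hψ)
  exact ⟨key s t h, key t s fun N hN w hw => (h N hN w hw).symm⟩

end ofClass

/-! ### Characterizations in terms of Suszko reduced models -/

theorem comp_vec_one {A B : Type*} (h : A → B) (a : A) : h ∘ ![a] = ![h a] := by
  funext i
  fin_cases i
  rfl

theorem comp_vec_two {A B : Type*} (h : A → B) (a b : A) : h ∘ ![a, b] = ![h a, h b] := by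
  funext i
  fin_cases i <;> rfl

/-- If `Δ(a,b)` is designated for a filter, it is so for every larger one, which puts `(a,b)` in the
Suszko congruence. Conversely, a model and its reduction designate the same values. -/
theorem mem_equivl_iff {S : Logic.{u}} : S ∈ Equivl ↔ ∃ Δ : Set (S.lang.Term (Fin 2)),
    Δ.Nonempty ∧ ∀ M ∈ S.ModEquiv, ∀ a b : M.carrier,
      (∀ δ ∈ Δ, δ.realize ![a, b] ∈ M.filter) ↔ a = b := by
  constructor
  · rintro ⟨Δ, hne, hΔ⟩
    refine ⟨Δ, hne, fun M hM a b => ⟨fun h => ?_, ?_⟩⟩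
    · refine hM.2 a b fun G hG hMG => ?_
      exact (hΔ ⟨M.carrier, G⟩ hG a b).2 fun δ hδ => hMG (h δ hδ)
    · rintro rfl
      exact (hΔ M hM.1 a a).1 (LeibnizCongr.refl _ a)
  · rintro ⟨Δ, hne, hΔ⟩
    refine ⟨Δ, hne, fun M hM a b => ?_⟩
    obtain ⟨N, hN, h, -, hh, hp, hk⟩ := Logic.exists_reduction (S := S) (F := M.filter) hM
    rw [← hk, ← hΔ N hN]
    refine forall₂_congr fun δ _ => ?_
    rw [← hp, Set.mem_preimage, hh.realize, comp_vec_two]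

/-- The congruence formulas with parameters are `δ(t(x,z⃗), t(y,z⃗))` for all terms `t`: modus
ponens then transfers membership in the filter along every polynomial. -/
theorem mem_proto_of_forall {S : Logic.{u}} (Δ : Set (S.lang.Term (Fin 2))) (hne : Δ.Nonempty)
    (hrefl : ∀ M ∈ S.Mod, ∀ a : M.carrier, ∀ δ ∈ Δ, δ.realize ![a, a] ∈ M.filter)
    (hmp : ∀ M ∈ S.Mod, ∀ a b : M.carrier, a ∈ M.filter →
      (∀ δ ∈ Δ, δ.realize ![a, b] ∈ M.filter) → b ∈ M.filter) : S ∈ Proto := by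
  let inst (t : S.lang.Term (Option S.Var)) (δ : S.lang.Term (Fin 2)) :
      S.lang.Term (Fin 2 ⊕ S.Var) :=
    δ.subst ![t.relabel fun o => o.elim (Sum.inl 0) Sum.inr,
      t.relabel fun o => o.elim (Sum.inl 1) Sum.inr]
  have hinst : ∀ (M : LogicalMatrix S.lang) (a b : M.carrier) (c : S.Var → M.carrier) t δ,
      (inst t δ).realize (Sum.elim ![a, b] c) =
        δ.realize ![t.realize fun o => o.elim a c, t.realize fun o => o.elim b c] := by
    intro M a b c t δ
    rw [Term.realize_subst]
    congr 1
    funext i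
    fin_cases i <;>
    · refine Term.realize_relabel.trans (congrArg (fun w => t.realize w) ?_)
      funext o
      cases o <;> rfl
  refine ⟨Set.range fun p : _ × Δ => inst p.1 p.2, ?_, fun M hM a b => ⟨?_, fun h => ?_⟩⟩
  · obtain ⟨δ, hδ⟩ := hne
    exact ⟨_, ⟨(Term.var none, ⟨δ, hδ⟩), rfl⟩⟩
  · rintro hab c _ ⟨⟨t, δ, hδ⟩, rfl⟩
    simp only [hinst]
    refine LeibnizCongr.mem_iff (L := S.lang) (LeibnizCongr.realize δ ?_) |>.1
      (hrefl M hM (t.realize fun o => o.elim a c) δ hδ)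
    have : LeibnizCongr S.lang M.filter (t.realize fun o => o.elim a c)
        (t.realize fun o => o.elim b c) := by
      apply LeibnizCongr.realize
      rintro (_ | x)
      · exact hab
      · exact LeibnizCongr.refl M.filter (c x)
    intro i
    fin_cases i
    · exact LeibnizCongr.refl M.filter _
    · exact this
  · have hδ : ∀ (p : S.lang.Term (Option M.carrier)), ∀ δ ∈ Δ,
        δ.realize ![p.realize fun o => o.elim a id, p.realize fun o => o.elim b id] ∈
          M.filter := by
      intro p δ hδ
      obtain ⟨U, hU, hp⟩ := exists_finite_support p
      obtain ⟨g, w, hw⟩ := exists_relabel S.Var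
        (hU.preimage (Option.some_injective M.carrier).injOn) id
      have := h w _ ⟨(p.relabel (Option.map g), ⟨δ, hδ⟩), rfl⟩
      simp only [hinst] at this
      have e : ∀ d : M.carrier, (p.relabel (Option.map g)).realize (fun o => o.elim d w) =
          p.realize fun o => o.elim d id := by
        intro d
        rw [Term.realize_relabel]
        apply hp
        rintro (_ | x) hx
        · rfl
        · exact hw x hx
      rwa [e, e] at this
    have one : ∀ (p : S.lang.Term (Option M.carrier)), (p.realize fun o => o.elim a id) ∈ M.filter →
        (p.realize fun o => o.elim b id) ∈ M.filter :=
      fun p hp => hmp M hM _ _ hp (hδ p)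
    refine leibnizCongr_iff.2 fun p => ⟨one p, fun hp => hmp M hM _ _ hp fun δ hδ => ?_⟩
    -- The converse direction uses the polynomial `q(d) = δ(p(d), p(a))`: `q(a)` is designated by
    -- reflexivity, hence so is `q(b) = δ(p(b), p(a))`, and modus ponens applies.
    let q : S.lang.Term (Option M.carrier) :=
      δ.subst ![p, p.relabel fun o => some (o.elim a id)]
    have hq : ∀ d : M.carrier, (q.realize fun o => o.elim d id) =
        δ.realize ![p.realize fun o => o.elim d id, p.realize fun o => o.elim a id] := by
      intro d
      rw [Term.realize_subst]
      congr 1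
      funext i
      fin_cases i
      · rfl
      · exact Term.realize_relabel
    have := one q
    rw [hq, hq] at this
    exact this (hrefl M hM _ δ hδ)

/-- The terms in `n + 2` variables that take designated values in all models when their first
two variables are identified. -/
def reflTerms (S : Logic.{u}) (n : ℕ) : Set (S.lang.Term (Fin (n + 2))) :=
  {t | ∀ M ∈ S.Mod, ∀ v : Fin (n + 2) → M.carrier, v 0 = v 1 → t.realize v ∈ M.filter}

-- Only finitely many parameters occur in a term: `z` lists them and `r` sends each to its position,
-- with the irrelevant default `0` for the others.
open Matrix in
theorem exists_term_fin {W : Type*} (t : L.Term (Fin 2 ⊕ W)) :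
    ∃ (n : ℕ) (z : Fin n → W) (r : W → Fin (n + 2)) (s : L.Term (Fin (n + 2))),
      (∀ (A : Type u) [L.Structure A] (a b : A) (c : W → A),
        t.realize (Sum.elim ![a, b] c) = s.realize (vecCons a (vecCons b (c ∘ z)))) ∧
      ∀ (A : Type u) [L.Structure A] (v : Fin (n + 2) → A),
        s.realize v = t.realize (Sum.elim ![v 0, v 1] (v ∘ r)) := by
  classical
  obtain ⟨U, hU, ht⟩ := exists_finite_support t
  let X : Set W := Sum.inr ⁻¹' U
  have : Finite X := hU.preimage Sum.inr_injective.injOn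
  let e := Finite.equivFin X
  let r : W → Fin (Nat.card X + 2) := fun k => if h : k ∈ X then (e ⟨k, h⟩).succ.succ else 0
  refine ⟨Nat.card X, fun i => e.symm i, r, t.relabel (Sum.elim ![0, 1] r), ?_, ?_⟩
  · intro A _ a b c
    rw [Term.realize_relabel]
    apply ht
    rintro (i | k) hk
    · fin_cases i <;> rfl
    · have : k ∈ X := hk
      simp only [Sum.elim_inr, Function.comp_apply, r, this, dif_pos, cons_val_succ]
      exact congrArg (fun y : X => c y) (e.symm_apply_apply ⟨k, this⟩).symm
  · intro A _ v
    rw [Term.realize_relabel]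
    congr 1
    funext x
    rcases x with i | k
    · fin_cases i <;> rfl
    · rfl

open Matrix in
/-- In a protoalgebraic logic the terms in `reflTerms` define the Leibniz congruence, with
parameters in a generating set. -/
theorem leibnizCongr_of_reflTerms {S : Logic.{u}} (hS : S ∈ Proto) {A : Type u} [Nonempty A]
    [S.lang.Structure A] {F : Set A} (hF : S.IsFilter F) {W : Type*} (c : W → A)
    (hc : ∀ d : A, ∃ t : S.lang.Term W, t.realize c = d) {a b : A}
    (h : ∀ n, ∀ t ∈ reflTerms S n, ∀ z : Fin n → W,
      t.realize (vecCons a (vecCons b (c ∘ z))) ∈ F) : LeibnizCongr S.lang F a b := by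
  obtain ⟨Δ, -, hΔ⟩ := hS
  refine (hΔ ⟨A, F⟩ hF a b).2 fun c' δ hδ => ?_
  choose p hp using fun x => hc (c' x)
  -- Each parameter is written as a term in the generators, so that only generators remain as
  -- parameters.
  let u : S.lang.Term (Fin 2 ⊕ W) :=
    δ.subst (Sum.elim (fun i => Term.var (Sum.inl i)) fun k => (p k).relabel Sum.inr)
  have hu : ∀ (B : Type u) [S.lang.Structure B] (w : Fin 2 → B) (d : W → B),
      u.realize (Sum.elim w d) = δ.realize (Sum.elim w fun k => (p k).realize d) := by
    intro B _ w d
    rw [Term.realize_subst]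
    congr 1
    funext x
    rcases x with i | k
    · rfl
    · exact Term.realize_relabel
  obtain ⟨n, z, r, s, hs, hs'⟩ := exists_term_fin u
  have hmem : s ∈ reflTerms S n := by
    intro M hM v hv
    rw [hs', hu, hv]
    exact (hΔ M hM _ _).1 (LeibnizCongr.refl M.filter (v 1)) _ δ hδ
  have := h n s hmem z
  rw [← hs, hu] at this
  simpa only [hp] using this

-- Membership of these values passes to every larger filter, so `a` and `b` are Suszko congruent;
-- all elements serve as generators.
open Matrix in
theorem eq_of_reflTerms {S : Logic.{u}} (hS : S ∈ Proto) {M : LogicalMatrix S.lang}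
    (hM : M ∈ S.ModEquiv) {a b : M.carrier} (h : ∀ n, ∀ t ∈ reflTerms S n,
      ∀ z : Fin n → M.carrier, t.realize (vecCons a (vecCons b z)) ∈ M.filter) : a = b :=
  hM.2 a b fun _ hG hMG => leibnizCongr_of_reflTerms hS hG id (fun d => ⟨Term.var d, rfl⟩)
    fun n t ht z => hMG (h n t ht z)

theorem reflTerms_nonempty {S : Logic.{u}} (hS : S ∈ Proto) (n : ℕ) : (reflTerms S n).Nonempty := by
  obtain ⟨Δ, ⟨δ, hδ⟩, hΔ⟩ := hS
  refine ⟨δ.relabel (Sum.elim ![0, 1] fun _ => 0), fun M hM v hv => ?_⟩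
  have := (hΔ M hM (v 0) (v 0)).1 (LeibnizCongr.refl M.filter _) (fun _ => v 0) δ hδ
  rw [Term.realize_relabel]
  convert this using 2
  funext x
  rcases x with i | k
  · fin_cases i
    · rfl
    · exact hv.symm
  · rfl

/-- Pulled back to the term algebra on two generators, every parameter is one of the two compared
variables, so binary terms suffice. -/
theorem reflTerms_mp {S : Logic.{u}} (hS : S ∈ Proto) {A : Type u} [Nonempty A]
    [S.lang.Structure A] {F : Set A} (hF : S.IsFilter F) {a b : A} (ha : a ∈ F)
    (h : ∀ t ∈ reflTerms S 0, t.realize ![a, b] ∈ F) : b ∈ F := by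
  have hh := isHom_realize (L := S.lang) ![a, b]
  have := leibnizCongr_of_reflTerms hS (hF.preimage hh) Term.var
    (fun t : S.lang.Term (Fin 2) => ⟨t, by
      rw [realize_termStructure]
      induction t with
      | var x => rfl
      | func f ts ih => exact congrArg (Term.func f) (funext ih)⟩)
    (a := Term.var 0) (b := Term.var 1) fun n t ht z => by
      rw [Set.mem_preimage, hh.realize]
      have := h (t.relabel (Matrix.vecCons 0 (Matrix.vecCons 1 z))) fun M hM v hv => by
        rw [Term.realize_relabel]
        exact ht M hM _ hv
      rw [Term.realize_relabel] at this
      convert this using 2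
      funext i
      refine Fin.cases rfl (fun i => ?_) i
      refine Fin.cases rfl (fun i => rfl) i
  exact this.mem_iff.1 ha

theorem mem_proto_iff {S : Logic.{u}} : S ∈ Proto ↔ ∃ Δ : Set (S.lang.Term (Fin 2)),
    Δ.Nonempty ∧ ∀ M ∈ S.ModEquiv, (∀ a : M.carrier, ∀ δ ∈ Δ, δ.realize ![a, a] ∈ M.filter) ∧
      ∀ a b : M.carrier, a ∈ M.filter → (∀ δ ∈ Δ, δ.realize ![a, b] ∈ M.filter) →
        b ∈ M.filter := by
  constructor
  · intro hS
    exact ⟨reflTerms S 0, reflTerms_nonempty hS 0, fun M hM =>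
      ⟨fun a δ hδ => hδ M hM.1 _ rfl, fun a b ha h => reflTerms_mp hS hM.1 ha h⟩⟩
  · rintro ⟨Δ, hne, hΔ⟩
    refine mem_proto_of_forall Δ hne (fun M hM a δ hδ => ?_) fun M hM a b ha h => ?_
    · obtain ⟨N, hN, h, -, hh, hp, hk⟩ := Logic.exists_reduction (S := S) (F := M.filter) hM
      rw [← hp, Set.mem_preimage, hh.realize, comp_vec_two]
      exact (hΔ N hN).1 _ δ hδ
    · obtain ⟨N, hN, h, -, hh, hp, hk⟩ := Logic.exists_reduction (S := S) (F := M.filter) hM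
      simp only [← hp, Set.mem_preimage, hh.realize, comp_vec_two] at *
      exact (hΔ N hN).2 _ _ ha ‹_›

theorem mem_injctv_iff {S : Logic.{u}} : S ∈ Injctv ↔ ∃ φ : S.lang.Term (Fin 1),
    ∀ M ∈ S.ModEquiv, (∀ a : M.carrier, φ.realize ![a] ∈ M.filter) ∧
      Function.Injective fun a : M.carrier => φ.realize ![a] := by
  have e : ∀ {A : Type u} (a : A), ![a] = fun _ => a := fun a => funext fun i => by
    fin_cases i; rfl
  simp only [e]
  constructor
  · rintro ⟨φ, hφ, hi⟩
    refine ⟨φ, fun M hM => ⟨fun a => ?_, hi M hM⟩⟩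
    have := hM.1 _ _ (hφ (Classical.arbitrary _)) (fun _ => a) (by simp)
    rwa [Term.realize_relabel] at this
  · rintro ⟨φ, hφ⟩
    refine ⟨φ, fun x => Logic.entails_empty_of_forall _ fun M hM v => ?_, fun M hM => (hφ M hM).2⟩
    rw [Term.realize_relabel]
    exact (hφ M hM).1 (v x)

theorem mem_thrms_of_forall {S : Logic.{u}} (t : S.lang.Term (Fin 1))
    (h : ∀ M ∈ S.ModEquiv, ∀ a : M.carrier, t.realize (fun _ => a) ∈ M.filter) : S ∈ Thrms :=
  ⟨t.relabel fun _ => Classical.arbitrary S.Var,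
    Logic.entails_empty_of_forall _ fun M hM v => by
      rw [Term.realize_relabel]
      exact h M hM _⟩

theorem exists_term_of_mem_thrms {S : Logic.{u}} (hS : S ∈ Thrms) : ∃ t : S.lang.Term (Fin 1),
    ∀ M ∈ S.Mod, ∀ a : M.carrier, t.realize (fun _ => a) ∈ M.filter := by
  obtain ⟨φ, hφ⟩ := hS
  refine ⟨φ.relabel fun _ => 0, fun M hM a => ?_⟩
  rw [Term.realize_relabel]
  exact hM ∅ φ hφ _ (by simp)

/-! ### Closure under interpretability -/

theorem equivl_of_interpretable {S S' : Logic.{u}} (hS : S ∈ Equivl) (h : S.Interpretable S') :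
    S' ∈ Equivl := by
  obtain ⟨Δ, hne, hΔ⟩ := mem_equivl_iff.1 hS
  obtain ⟨τ, hτ⟩ := h
  refine mem_equivl_iff.2 ⟨τ.onTerm '' Δ, hne.image _, fun M hM a b => ?_⟩
  rw [Set.forall_mem_image]
  simp only [realize_onTerm]
  exact hΔ _ (hτ M hM) a b

theorem proto_of_interpretable {S S' : Logic.{u}} (hS : S ∈ Proto) (h : S.Interpretable S') :
    S' ∈ Proto := by
  obtain ⟨Δ, hne, hΔ⟩ := mem_proto_iff.1 hS
  obtain ⟨τ, hτ⟩ := h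
  refine mem_proto_iff.2 ⟨τ.onTerm '' Δ, hne.image _, fun M hM => ?_⟩
  simp only [Set.forall_mem_image, realize_onTerm]
  exact hΔ _ (hτ M hM)

theorem injctv_of_interpretable {S S' : Logic.{u}} (hS : S ∈ Injctv) (h : S.Interpretable S') :
    S' ∈ Injctv := by
  obtain ⟨φ, hφ⟩ := mem_injctv_iff.1 hS
  obtain ⟨τ, hτ⟩ := h
  refine mem_injctv_iff.2 ⟨τ.onTerm φ, fun M hM => ?_⟩
  simp only [realize_onTerm]
  exact hφ _ (hτ M hM)

theorem asrt_of_interpretable {S S' : Logic.{u}} (hS : S ∈ Asrt) (h : S.Interpretable S') :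
    S' ∈ Asrt := by
  obtain ⟨τ, hτ⟩ := h
  exact fun M hM => hS _ (hτ M hM)

theorem thrms_of_interpretable {S S' : Logic.{u}} (hS : S ∈ Thrms) (h : S.Interpretable S') :
    S' ∈ Thrms := by
  obtain ⟨t, ht⟩ := exists_term_of_mem_thrms hS
  obtain ⟨τ, hτ⟩ := h
  refine mem_thrms_of_forall (τ.onTerm t) fun M hM a => ?_
  rw [realize_onTerm]
  exact ht _ (hτ M hM).1 a

theorem equivl_subset_thrms : Equivl.{u} ⊆ Thrms := by
  intro S hS
  obtain ⟨Δ, ⟨δ, hδ⟩, hΔ⟩ := mem_equivl_iff.1 hS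
  refine mem_thrms_of_forall (δ.relabel fun _ => 0) fun M hM a => ?_
  have := (hΔ M hM a a).2 rfl δ hδ
  rw [Term.realize_relabel]
  convert this using 2
  funext i
  fin_cases i <;> rfl

theorem proto_subset_thrms : Proto.{u} ⊆ Thrms := by
  intro S hS
  obtain ⟨t, ht⟩ := reflTerms_nonempty hS 0
  refine mem_thrms_of_forall (t.relabel fun _ => 0) fun M hM a => ?_
  rw [Term.realize_relabel]
  exact ht M hM.1 _ rfl

/-! ### The language of parametrized implications -/

open Matrix

/-- The operation symbols of `implLanguage I`. -/
def ImplSymbol (I : Type u) : ℕ → Type u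
  | 0 => PEmpty
  | 1 => PUnit
  | _ + 2 => I

/-- The language with a unary symbol, and with symbols indexed by `I` of each arity `n + 2`. -/
abbrev implLanguage (I : Type u) : FirstOrder.Language.{u, 0} := ⟨ImplSymbol I, fun _ => Empty⟩

instance (I : Type u) : (implLanguage I).IsAlgebraic := fun _ => inferInstanceAs (IsEmpty Empty)

instance (I : Type u) : IsEmpty ((implLanguage I).Functions 0) := inferInstanceAs (IsEmpty PEmpty)

/-- The unary symbol. -/
def unary (I : Type u) : (implLanguage I).Functions 1 := PUnit.unit

/-- The symbol of arity `n + 2` with index `i`. -/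
def impl {I : Type u} (n : ℕ) (i : I) : (implLanguage I).Functions (n + 2) := i

/-- The translation of `implLanguage I` given by a unary term and by terms in `n + 2` variables. -/
def implTranslation {I : Type u} {L : FirstOrder.Language.{u, 0}} (φ : L.Term (Fin 1))
    (t : ∀ n, I → L.Term (Fin (n + 2))) : Translation (implLanguage I) L
  | 0, f => PEmpty.elim f
  | 1, _ => φ
  | n + 2, i => t n i

/-- The matrices in which the equality relation is defined by the binary symbols. -/
def equivlMatrices (I : Type u) : Set (LogicalMatrix (implLanguage I)) :=
  {M | ∀ a b : M.carrier, (∀ i : I, funMap (impl 0 i) ![a, b] ∈ M.filter) ↔ a = b}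

/-- The matrices in which the binary symbols form a protoimplication, and the others take
designated values when their first two arguments coincide. -/
def protoMatrices (I : Type u) : Set (LogicalMatrix (implLanguage I)) :=
  {M | (∀ n (i : I) (v : Fin (n + 2) → M.carrier), v 0 = v 1 → funMap (impl n i) v ∈ M.filter) ∧
    ∀ a b : M.carrier, a ∈ M.filter → (∀ i : I, funMap (impl 0 i) ![a, b] ∈ M.filter) →
      b ∈ M.filter}

/-- The matrices in `protoMatrices I` with at most one designated element. -/
def asrtMatrices (I : Type u) : Set (LogicalMatrix (implLanguage I)) :=
  {M | M ∈ protoMatrices I ∧ M.filter.Subsingleton}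

/-- The matrices in `protoMatrices I` in which the unary symbol takes designated values, and in
which the identification of two of its values makes its arguments indiscernible. -/
def injctvMatrices (I : Type u) : Set (LogicalMatrix (implLanguage I)) :=
  {M | M ∈ protoMatrices I ∧ (∀ a : M.carrier, funMap (unary I) ![a] ∈ M.filter) ∧
    ∀ (c : ULift.{u} ℕ → M.carrier) (x y : ULift.{u} ℕ),
      (∀ n (i : I) (z : Fin n → ULift.{u} ℕ), funMap (impl n i)
        (vecCons (funMap (unary I) ![c x]) (vecCons (funMap (unary I) ![c y]) (c ∘ z))) ∈
          M.filter) →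
      ∀ t : (implLanguage I).Term (Option (ULift.{u} ℕ)),
        (t.realize fun o => o.elim (c x) c) ∈ M.filter →
          (t.realize fun o => o.elim (c y) c) ∈ M.filter}

/-- The logic over countably many variables defined by a class of matrices for `implLanguage I`. -/
abbrev implLogic (I : Type u) (C : Set (LogicalMatrix (implLanguage I))) : Logic.{u} :=
  ofClass (implLanguage I) (ULift.{u} ℕ) C

/-- The term given by a binary symbol. -/
def implTerm {I : Type u} (i : I) : (implLanguage I).Term (Fin 2) :=
  Term.func (impl 0 i) ![Term.var 0, Term.var 1]

theorem realize_implTerm {I : Type u} (i : I) {A : Type u} [(implLanguage I).Structure A]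
    (v : Fin 2 → A) : (implTerm i).realize v = funMap (impl 0 i) ![v 0, v 1] := by
  simp only [implTerm, Term.realize_func]
  congr 1
  funext j
  fin_cases j <;> rfl

/-! ### Equivalential logics -/

theorem implLogic_equivl (I : Type u) [Nonempty I] :
    implLogic I (equivlMatrices I) ∈ Equivl := by
  refine mem_equivl_iff.2 ⟨Set.range implTerm, Set.range_nonempty _, fun M hM a b => ?_⟩
  simp only [Set.forall_mem_range]
  constructor
  · intro h
    have := realize_eq_of_mem_modEquiv_ofClass hM (Set.range implTerm) (Term.var 0) (Term.var 1)
      (fun N hN w hw => (hN _ _).1 fun i => ?_) ![a, b] (Set.forall_mem_range.2 h)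
    · exact this
    · have := hw _ ⟨i, rfl⟩
      rwa [realize_implTerm] at this
  · rintro rfl i
    have := mem_of_isFilter_ofClass_of_finite' hM.1 ![a] ∅
      ((implTerm i).relabel fun _ => (0 : Fin 1)) (fun N hN w _ => ?_) (by simp)
    · rw [Term.realize_relabel] at this
      convert this using 2
      funext j
      fin_cases j <;> rfl
    · rw [Term.realize_relabel, realize_implTerm]
      exact (hN _ _).2 rfl i

theorem implLogic_interpretable_of_equivl {S : Logic.{u}} {Δ : Set (S.lang.Term (Fin 2))}
    (hΔ : ∀ M ∈ S.ModEquiv, ∀ a b : M.carrier, (∀ δ ∈ Δ, δ.realize ![a, b] ∈ M.filter) ↔ a = b)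
    {I : Type u} {g : I → Δ} (hg : Function.Surjective g) :
    (implLogic I (equivlMatrices I)).Interpretable S := by
  let τ : Translation (implLanguage I) S.lang := implTranslation (Term.var 0) fun n i =>
    (g i : S.lang.Term (Fin 2)).relabel ![0, 1]
  refine ⟨τ, fun M hM => ?_⟩
  have hmem : M.translate τ ∈ equivlMatrices I := by
    intro (a : M.carrier) (b : M.carrier)
    refine Iff.trans ?_ (hΔ M hM a b)
    change (∀ i : I, ((g i : S.lang.Term (Fin 2)).relabel ![0, 1]).realize ![a, b] ∈ M.filter) ↔ _
    have e : ∀ i, ((g i : S.lang.Term (Fin 2)).relabel ![0, 1]).realize ![a, b] =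
        (g i : S.lang.Term (Fin 2)).realize ![a, b] := fun i => by
      rw [Term.realize_relabel]
      congr 1
      funext j
      fin_cases j <;> rfl
    simp only [e]
    exact ⟨fun h δ hδ => by
        obtain ⟨i, hi⟩ := hg ⟨δ, hδ⟩
        have := h i
        rw [hi] at this
        exact this,
      fun h i => h _ (g i).2⟩
  refine Logic.mem_modEquiv_of_leibniz (isFilter_ofClass_of_mem hmem) fun a b hab => ?_
  refine (hmem a b).1 fun i => ?_
  have := LeibnizCongr.realize (implTerm i) (v := ![a, a]) (w := ![a, b]) fun j => by
    fin_cases j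
    · exact LeibnizCongr.refl (LogicalMatrix.filter _) a
    · exact hab
  rw [realize_implTerm, realize_implTerm] at this
  exact this.mem_iff.1 ((hmem a a).2 rfl i)

/-- `Option` keeps the index type non-empty at the ordinal `0`. -/
theorem exists_surjective_toType (T : Type u) [Nonempty T] :
    ∃ α : Ordinal.{u}, ∀ β ≥ α, ∃ g : Option β.ToType → T, Function.Surjective g := by
  refine ⟨(Cardinal.mk T).ord, fun β hβ => ?_⟩
  have h : Cardinal.mk T ≤ Cardinal.mk β.ToType := by
    rw [Cardinal.mk_toType]
    exact Cardinal.ord_le.1 hβ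
  obtain ⟨e⟩ := h
  exact ⟨_, Function.invFun_surjective (e.trans Function.Embedding.some).injective⟩

theorem isLeibnizClass_equivl : IsLeibnizClass Equivl.{u} := by
  refine isLeibnizClass_of_eventually_interpretable
    (fun α => implLogic (Option α.ToType) (equivlMatrices _)) (fun α => implLogic_equivl _)
    (fun S hS S' h => equivl_of_interpretable hS h) fun S hS => ?_
  obtain ⟨Δ, hne, hΔ⟩ := mem_equivl_iff.1 hS
  have := hne.to_subtype
  obtain ⟨α, hα⟩ := exists_surjective_toType Δ
  refine ⟨α, fun β hβ => ?_⟩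
  obtain ⟨g, hg⟩ := hα β hβ
  exact implLogic_interpretable_of_equivl hΔ hg

/-! ### Protoalgebraic logics -/

theorem mem_protoMatrices_of_mem_mod {I : Type u} {C : Set (LogicalMatrix (implLanguage I))}
    (hC : C ⊆ protoMatrices I) {M : LogicalMatrix (implLanguage I)}
    (hM : M ∈ (implLogic I C).Mod) : M ∈ protoMatrices I := by
  refine ⟨fun n i v hv => ?_, fun a b ha h => ?_⟩
  -- Elements of the model serve as variables, so `v 0 = v 1` becomes an identification of variables
  -- in a term.
  · refine mem_of_isFilter_ofClass_of_finite hM (Set.finite_range v) id ∅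
      (Term.func (impl n i) fun j => Term.var (v j)) (by simp) ?_ ?_ (by simp)
    · intro A _ w w' hw
      simp only [Term.realize_func, Term.realize_var]
      congr 1
      funext j
      exact hw ⟨j, rfl⟩
    · intro N hN w _
      exact (hC hN).1 n i _ (congrArg w hv)
  · refine mem_of_isFilter_ofClass_of_finite' hM ![a, b]
      (insert (Term.var 0) (Set.range implTerm)) (Term.var 1) ?_ ?_
    · intro N hN w hw
      refine (hC hN).2 _ _ (hw _ (Set.mem_insert _ _)) fun i => ?_
      have := hw _ (Set.mem_insert_of_mem _ ⟨i, rfl⟩)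
      rwa [realize_implTerm] at this
    · rintro _ (rfl | ⟨i, rfl⟩)
      · exact ha
      · rw [realize_implTerm]
        exact h i

theorem implLogic_proto {I : Type u} [Nonempty I] {C : Set (LogicalMatrix (implLanguage I))}
    (hC : C ⊆ protoMatrices I) : implLogic I C ∈ Proto := by
  refine mem_proto_of_forall (Set.range implTerm) (Set.range_nonempty _) ?_ ?_
  · rintro M hM a _ ⟨i, rfl⟩
    rw [realize_implTerm]
    exact (mem_protoMatrices_of_mem_mod hC hM).1 0 i _ rfl
  · intro M hM a b ha h
    refine (mem_protoMatrices_of_mem_mod hC hM).2 a b ha fun i => ?_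
    have := h _ ⟨i, rfl⟩
    rwa [realize_implTerm] at this

theorem implLogic_asrt (I : Type u) [Nonempty I] :
    implLogic I (asrtMatrices I) ∈ Asrt := by
  intro M hM
  have hP := mem_protoMatrices_of_mem_mod (fun _ h => h.1) hM.1
  refine Set.exists_eq_singleton_iff_nonempty_subsingleton.2
    ⟨⟨_, hP.1 0 (Classical.arbitrary I) (fun _ => Classical.arbitrary M.carrier) rfl⟩,
      fun a ha b hb => ?_⟩
  refine realize_eq_of_mem_modEquiv_ofClass hM {Term.var 0, Term.var 1} (Term.var 0) (Term.var 1)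
    (fun N hN w hw => hN.2 (hw _ (by simp)) (hw _ (by simp))) ![a, b] ?_
  rintro _ (rfl | rfl)
  · exact ha
  · exact hb

/-- The last condition on `injctvMatrices` is a family of rules with infinitely many premises in
countably many variables, exactly those of the logic; hence all models inherit it. -/
theorem mem_injctvMatrices_of_mem_mod {I : Type u} {M : LogicalMatrix (implLanguage I)}
    (hM : M ∈ (implLogic I (injctvMatrices I)).Mod) : M ∈ injctvMatrices I := by
  refine ⟨mem_protoMatrices_of_mem_mod (fun _ h => h.1) hM, fun a => ?_, fun c x y h t ht => ?_⟩
  · have := mem_of_isFilter_ofClass_of_finite' hM ![a] ∅ (Term.func (unary I) ![Term.var 0])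
      (fun N hN w _ => ?_) (by simp)
    · simp only [Term.realize_func] at this
      convert this using 2
      funext j
      fin_cases j
      rfl
    · have := hN.2.1 (w 0)
      simp only [Term.realize_func]
      convert this using 2
      funext j
      fin_cases j
      rfl
  · let q (x : ULift.{u} ℕ) : (implLanguage I).Term (ULift.{u} ℕ) :=
      Term.func (unary I) ![Term.var x]
    have hq : ∀ (N : LogicalMatrix (implLanguage I)) (w : ULift.{u} ℕ → N.carrier) x,
        (q x).realize w = funMap (unary I) ![w x] := by
      intro N w x
      simp only [q, Term.realize_func]
      congr 1
      funext j
      fin_cases j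
      rfl
    let p (n : ℕ) (i : I) (z : Fin n → ULift.{u} ℕ) : (implLanguage I).Term (ULift.{u} ℕ) :=
      Term.func (impl n i) (vecCons (q x) (vecCons (q y) fun j => Term.var (z j)))
    have hp : ∀ (N : LogicalMatrix (implLanguage I)) (w : ULift.{u} ℕ → N.carrier) n i z,
        (p n i z).realize w = funMap (impl n i) (vecCons (funMap (unary I) ![w x])
          (vecCons (funMap (unary I) ![w y]) (w ∘ z))) := by
      intro N w n i z
      simp only [p, Term.realize_func]
      congr 1
      funext j
      refine Fin.cases (hq N w x) (fun j => ?_) j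
      exact Fin.cases (hq N w y) (fun j => rfl) j
    have hr : ∀ (N : LogicalMatrix (implLanguage I)) (w : ULift.{u} ℕ → N.carrier) x,
        (t.relabel fun o => o.elim x id).realize w = t.realize fun o => o.elim (w x) w := by
      intro N w x
      rw [Term.realize_relabel]
      congr 1
      funext o
      cases o <;> rfl
    rw [← hr]
    refine hM (insert (t.relabel fun o => o.elim x id) {ψ | ∃ n i z, ψ = p n i z})
      (t.relabel fun o => o.elim y id) (fun N hN w hw => ?_) c ?_
    · rw [hr]
      refine hN.2.2 w x y (fun n i z => ?_) t ?_
      · rw [← hp]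
        exact hw _ (Set.mem_insert_of_mem _ ⟨n, i, z, rfl⟩)
      · rw [← hr]
        exact hw _ (Set.mem_insert _ _)
    · rintro _ (rfl | ⟨n, i, z, rfl⟩)
      · rw [hr]
        exact ht
      · rw [hp]
        exact h n i z

theorem implLogic_injctv (I : Type u) : implLogic I (injctvMatrices I) ∈ Injctv := by
  refine mem_injctv_iff.2 ⟨Term.func (unary I) Term.var, fun M hM => ⟨fun a => ?_, ?_⟩⟩
  · exact (mem_injctvMatrices_of_mem_mod hM.1).2.1 a
  · intro a b hab
    replace hab : funMap (unary I) ![a] = funMap (unary I) ![b] := hab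
    refine hM.2 a b fun G hG hMG => leibnizCongr_iff.2 fun t => ?_
    have key : ∀ a b : M.carrier, funMap (unary I) ![a] = funMap (unary I) ![b] →
        (t.realize fun o => o.elim a id) ∈ G → (t.realize fun o => o.elim b id) ∈ G := by
      intro a b hab ht
      have hP := mem_injctvMatrices_of_mem_mod (M := ⟨M.carrier, G⟩) hG
      obtain ⟨U, hU, hs⟩ := exists_finite_support t
      obtain ⟨g, w, hw⟩ := exists_relabel (ULift.{u} ℕ)
        (((hU.preimage (Option.some_injective M.carrier).injOn).insert a).insert b) id
      have e : ∀ d : M.carrier, ((t.relabel (Option.map g)).realize fun o => o.elim d w) =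
          t.realize fun o => o.elim d id := by
        intro d
        rw [Term.realize_relabel]
        apply hs
        rintro (_ | x) hx
        · rfl
        · exact hw x (Or.inr (Or.inr hx))
      have ha : w (g a) = a := hw a (by simp)
      have hb : w (g b) = b := hw b (by simp)
      -- Equal values of the unary symbol make all premises instances of reflexivity.
      have := hP.2.2 w (g a) (g b) (fun n i z => hP.1.1 n i _ ?_) (t.relabel (Option.map g))
      · simp only [ha, hb] at this
        rw [e a, e b] at this
        exact this ht
      · simp only [ha, hb]
        exact hab
    exact ⟨key a b hab, key b a hab.symm⟩

section

variable {S : Logic.{u}} {I : Type u} (φ : S.lang.Term (Fin 1)) (g : ∀ n, I → reflTerms S n)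

/-- The translation that sends the symbols of arity `n + 2` to reflexive terms of `S`. -/
abbrev reflTranslation : Translation (implLanguage I) S.lang :=
  implTranslation φ fun n i => (g n i : S.lang.Term (Fin (n + 2)))

theorem translate_mem_protoMatrices (hg : ∀ n, Function.Surjective (g n)) (hS : S ∈ Proto)
    {M : LogicalMatrix S.lang} (hM : M ∈ S.Mod) :
    M.translate (reflTranslation φ g) ∈ protoMatrices I := by
  refine ⟨fun n i v hv => (g n i).2 M hM v hv, fun a b ha h => ?_⟩
  refine reflTerms_mp hS hM ha fun t ht => ?_
  obtain ⟨i, rfl⟩ := (hg 0 ⟨t, ht⟩).imp fun _ h => congrArg Subtype.val h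
  exact h i

/-- Every reflexive term is now a basic operation, so Leibniz congruent `a`, `b` designate all
values at `(a,b,z)` along with those at `(a,a,z)`. -/
theorem reflTranslation_mem_modEquiv (hg : ∀ n, Function.Surjective (g n)) (hS : S ∈ Proto)
    {C : Set (LogicalMatrix (implLanguage I))} {M : LogicalMatrix S.lang} (hM : M ∈ S.ModEquiv)
    (h : M.translate (reflTranslation φ g) ∈ C) :
    M.translate (reflTranslation φ g) ∈ (implLogic I C).ModEquiv := by
  have hP := translate_mem_protoMatrices φ g hg hS hM.1
  refine Logic.mem_modEquiv_of_leibniz (isFilter_ofClass_of_mem h) fun a b hab => ?_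
  refine eq_of_reflTerms hS hM fun n t ht z => ?_
  obtain ⟨i, rfl⟩ := (hg n ⟨t, ht⟩).imp fun _ h => congrArg Subtype.val h
  have := LeibnizCongr.realize (F := (M.translate (reflTranslation φ g)).filter)
    (Term.func (impl n i) Term.var)
    (v := vecCons a (vecCons a z)) (w := vecCons a (vecCons b z)) fun j => by
      refine Fin.cases (LeibnizCongr.refl _ a) (fun j => ?_) j
      exact Fin.cases hab (fun j =>
        LeibnizCongr.refl (M.translate (reflTranslation φ g)).filter (z j)) j
  exact this.mem_iff.1 (hP.1 n i _ rfl)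

end

/-- A surjection onto the product of the sets of reflexive terms serves all arities at once. -/
theorem exists_surjective_reflTerms {S : Logic.{u}} (hS : S ∈ Proto) : ∃ α : Ordinal.{u}, ∀ β ≥ α,
    ∃ g : ∀ n, Option β.ToType → reflTerms S n, ∀ n, Function.Surjective (g n) := by
  have := fun n => (reflTerms_nonempty hS n).to_subtype
  obtain ⟨α, hα⟩ := exists_surjective_toType (∀ n, reflTerms S n)
  refine ⟨α, fun β hβ => ?_⟩
  obtain ⟨g, hg⟩ := hα β hβ
  exact ⟨fun n i => g i n, fun n => (Function.surjective_eval n).comp hg⟩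

theorem isLeibnizClass_proto_inter_asrt : IsLeibnizClass (Proto.{u} ∩ Asrt) := by
  refine isLeibnizClass_of_eventually_interpretable
    (fun α => implLogic (Option α.ToType) (asrtMatrices _))
    (fun α => ⟨implLogic_proto fun _ h => h.1, implLogic_asrt _⟩)
    (fun S hS S' h => ⟨proto_of_interpretable hS.1 h, asrt_of_interpretable hS.2 h⟩) ?_
  rintro S ⟨hP, hA⟩
  obtain ⟨α, hα⟩ := exists_surjective_reflTerms hP
  refine ⟨α, fun β hβ => ?_⟩
  obtain ⟨g, hg⟩ := hα β hβ
  refine ⟨reflTranslation (Term.var 0) g, fun M hM =>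
    reflTranslation_mem_modEquiv _ g hg hP hM ⟨translate_mem_protoMatrices _ g hg hP hM.1, ?_⟩⟩
  obtain ⟨a, ha⟩ := hA M hM
  change M.filter.Subsingleton
  rw [ha]
  exact Set.subsingleton_singleton

/-- Pull the filter back along `c` to the term algebra. The premises make `φ(x)` and `φ(y)` Leibniz
congruent there, since variables suffice as parameters; injectivity of `φ` in the reduction of this
term matrix then makes `x` and `y` congruent. -/
theorem translate_mem_injctvMatrices {S : Logic.{u}} {I : Type u} {φ : S.lang.Term (Fin 1)}
    (hφ : ∀ M ∈ S.ModEquiv, (∀ a : M.carrier, φ.realize ![a] ∈ M.filter) ∧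
      Function.Injective fun a : M.carrier => φ.realize ![a]) (g : ∀ n, I → reflTerms S n)
    (hg : ∀ n, Function.Surjective (g n)) (hS : S ∈ Proto) {M : LogicalMatrix S.lang}
    (hM : M ∈ S.ModEquiv) : M.translate (reflTranslation φ g) ∈ injctvMatrices I := by
  refine ⟨translate_mem_protoMatrices φ g hg hS hM.1, fun a => ?_, fun c x y h t ht => ?_⟩
  · exact (hφ M hM).1 a
  · let c' : ULift.{u} ℕ → M.carrier := c
    have hh := isHom_realize (L := S.lang) c'
    have hH : S.IsFilter ((fun t : S.lang.Term (ULift.{u} ℕ) => t.realize c') ⁻¹' M.filter) :=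
      Logic.IsFilter.preimage hh hM.1
    have key : LeibnizCongr S.lang
        ((fun t : S.lang.Term (ULift.{u} ℕ) => t.realize c') ⁻¹' M.filter)
        (φ.realize ![Term.var x]) (φ.realize ![Term.var y]) := by
      refine leibnizCongr_of_reflTerms hS hH Term.var (fun t => ⟨t, ?_⟩) fun n t ht z => ?_
      · rw [realize_termStructure]
        induction t with
        | var x => rfl
        | func f ts ih => exact congrArg (Term.func f) (funext ih)
      · rw [Set.mem_preimage, hh.realize]
        obtain ⟨i, rfl⟩ := (hg n ⟨t, ht⟩).imp fun _ h => congrArg Subtype.val h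
        refine (congrArg (fun v => (g n i : S.lang.Term (Fin (n + 2))).realize v ∈ M.filter)
          (funext fun j => ?_)).mp (h n i z)
        have e : ∀ x, φ.realize (M := M.carrier) ![c' x] =
            Term.realize (L := S.lang) c'
              (φ.realize (M := S.lang.Term (ULift.{u} ℕ)) ![Term.var x]) := fun x => by
          rw [hh.realize φ, comp_vec_one]
          rfl
        refine Fin.cases (e x) (fun j => ?_) j
        exact Fin.cases (e y) (fun j => rfl) j
    obtain ⟨N, hN, k, -, hk, hp, hker⟩ := Logic.exists_reduction hH
    rw [← hker, hk.realize, hk.realize, comp_vec_one, comp_vec_one] at key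
    have := (hker _ _).1 ((hφ N hN).2 key)
    have := LeibnizCongr.realize ((reflTranslation φ g).onTerm t)
      (v := fun o => o.elim (Term.var x) Term.var) (w := fun o => o.elim (Term.var y) Term.var)
      fun o => by
        cases o
        · exact this
        · exact LeibnizCongr.refl _ _
    have := this.mem_iff
    simp only [Set.mem_preimage, hh.realize] at this
    have e : ∀ x, ((reflTranslation φ g).onTerm t).realize (M := M.carrier)
        ((fun t : S.lang.Term (ULift.{u} ℕ) => t.realize c') ∘
          fun o : Option (ULift.{u} ℕ) => o.elim (Term.var x) Term.var) =
        t.realize (M := (M.translate (reflTranslation φ g)).carrier)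
          fun o => o.elim (c x) c := by
      intro x
      refine (realize_onTerm _ M t _).trans (congrArg
        (fun w => t.realize (M := (M.translate (reflTranslation φ g)).carrier) w)
        (funext fun o => ?_))
      cases o <;> rfl
    exact (congrArg (· ∈ M.filter) (e y)).mp
      (this.1 ((congrArg (· ∈ M.filter) (e x)).mpr ht))

theorem isLeibnizClass_proto_inter_injctv : IsLeibnizClass (Proto.{u} ∩ Injctv) := by
  refine isLeibnizClass_of_eventually_interpretable
    (fun α => implLogic (Option α.ToType) (injctvMatrices _))
    (fun α => ⟨implLogic_proto fun _ h => h.1, implLogic_injctv _⟩)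
    (fun S hS S' h => ⟨proto_of_interpretable hS.1 h, injctv_of_interpretable hS.2 h⟩) ?_
  rintro S ⟨hP, hI⟩
  obtain ⟨φ, hφ⟩ := mem_injctv_iff.1 hI
  obtain ⟨α, hα⟩ := exists_surjective_reflTerms hP
  refine ⟨α, fun β hβ => ?_⟩
  obtain ⟨g, hg⟩ := hα β hβ
  exact ⟨reflTranslation φ g, fun M hM => reflTranslation_mem_modEquiv _ g hg hP hM
    (translate_mem_injctvMatrices hφ g hg hP hM)⟩

/-! ### Products of two logics -/

theorem isEmpty_term {L : FirstOrder.Language.{u, 0}} [IsEmpty (L.Functions 0)] {W : Type*}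
    [IsEmpty W] : IsEmpty (L.Term W) := by
  refine ⟨fun t => ?_⟩
  induction t with
  | var x => exact isEmptyElim x
  | @func l f ts ih =>
    cases l with
    | zero => exact isEmptyElim f
    | succ n => exact ih 0

/-- The language of the non-indexed product: its `n`-ary symbols are the families of `n`-ary
terms of the factors. -/
abbrev prodLanguage (S : Bool → Logic.{u}) : FirstOrder.Language.{u, 0} :=
  ⟨fun n => ∀ b, (S b).lang.Term (Fin n), fun _ => Empty⟩

section

variable (S : Bool → Logic.{u})

instance : (prodLanguage S).IsAlgebraic := fun _ => inferInstanceAs (IsEmpty Empty)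

instance : IsEmpty ((prodLanguage S).Functions 0) :=
  ⟨fun f => isEmpty_term.elim (f true)⟩

-- The product logic gets the variables of each factor and one extra per factor, which will name the
-- base point in `isFilter_factor`.
instance : Infinite (Σ b, Option (S b).Var) :=
  Infinite.of_injective (fun x : (S true).Var => (⟨true, some x⟩ : Σ b, Option (S b).Var))
    fun x y h => by simpa using h

/-- The projection of the product language onto the language of a factor. -/
def proj (b : Bool) : Translation (prodLanguage S) (S b).lang := fun _ F => F b

variable {S} in
/-- `h` is a homomorphism into an algebra of the factor `b`, along the projection `proj S b`. -/
def IsProj {b : Bool} {A B : Type u} [(prodLanguage S).Structure A] [(S b).lang.Structure B]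
    (h : A → B) : Prop :=
  ∀ (n : ℕ) (F : (prodLanguage S).Functions n) (v : Fin n → A),
    h (funMap F v) = (F b).realize (h ∘ v)

variable {S} in
theorem IsProj.realize {b : Bool} {A B : Type u} [(prodLanguage S).Structure A]
    [(S b).lang.Structure B] {h : A → B} (hh : IsProj (S := S) (b := b) h) {W : Type*}
    (t : (prodLanguage S).Term W) (v : W → A) :
    h (t.realize v) = ((proj S b).onTerm t).realize (h ∘ v) := by
  induction t with
  | var x => rfl
  | func F ts ih =>
    simp only [Translation.onTerm, Term.substFunc, Term.realize_subst, Term.realize_func,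
      hh _ F] at ih ⊢
    exact congrArg (fun w => (F b).realize w) (funext ih)

/-- The matrices that embed into a product of models of the factors, and whose filter is
induced by those of the factors. -/
def prodMatrices : Set (LogicalMatrix (prodLanguage S)) :=
  {M | ∃ (N : ∀ b, LogicalMatrix (S b).lang) (h : ∀ b, M.carrier → (N b).carrier),
    (∀ b, N b ∈ (S b).Mod) ∧ (∀ b, IsProj (S := S) (b := b) (h b)) ∧
    (∀ x y, (∀ b, h b x = h b y) → x = y) ∧ ∀ x, x ∈ M.filter ↔ ∀ b, h b x ∈ (N b).filter}

/-- The non-indexed product of two logics. -/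
abbrev prodLogic : Logic.{u} :=
  ofClass (prodLanguage S) (Σ b, Option (S b).Var) (prodMatrices S)

/-- The binary operation that takes the component `b` from its first argument and the other one
from the second. -/
def merge (b : Bool) : (prodLanguage S).Functions 2 :=
  fun c => if c = b then Term.var 0 else Term.var 1

variable {S}

theorem IsProj.funMap_merge {b c : Bool} {A B : Type u} [(prodLanguage S).Structure A]
    [(S c).lang.Structure B] {h : A → B} (hh : IsProj (S := S) (b := c) h) (x y : A) :
    h (funMap (merge S b) ![x, y]) = if c = b then h x else h y := by
  rw [hh]
  unfold merge
  split_ifs <;> rfl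

/-- The operation of the product that is given by a symbol of a factor. -/
def liftSymbol (b : Bool) : ∀ {n : ℕ}, (S b).lang.Functions n → (prodLanguage S).Functions n
  -- The inactive component is an arbitrary variable, available because arities are positive.
  | 0, f => isEmptyElim f
  | n + 1, f => Function.update (β := fun c => (S c).lang.Term (Fin (n + 1)))
      (fun _ => Term.var 0) b (Term.func f Term.var)

theorem liftSymbol_self (b : Bool) {n : ℕ} (f : (S b).lang.Functions n) :
    liftSymbol b f b = Term.func f Term.var := by
  cases n with
  | zero => exact isEmptyElim f
  | succ n =>
    exact Function.update_self (β := fun c => (S c).lang.Term (Fin (n + 1))) b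
      (Term.func f Term.var) fun _ => Term.var 0

variable (S) in
/-- The translation of the language of a factor into that of the product. -/
def lift (b : Bool) : Translation (S b).lang (prodLanguage S) :=
  fun _ f => Term.func (liftSymbol b f) Term.var

theorem proj_lift (b : Bool) {W : Type*} (t : (S b).lang.Term W) :
    (proj S b).onTerm ((lift S b).onTerm t) = t := by
  induction t with
  | var x => rfl
  | func f ts ih =>
    simp only [Translation.onTerm, Term.substFunc, lift, Term.subst] at ih ⊢
    simp only [proj, liftSymbol_self, Term.subst]
    congr 1
    funext i
    exact ih i

theorem realize_eq_of_proj {M : LogicalMatrix (prodLanguage S)} (hM : M ∈ (prodLogic S).ModEquiv)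
    {W : Type*} [Finite W] (s t : (prodLanguage S).Term W)
    (h : ∀ b, (proj S b).onTerm s = (proj S b).onTerm t) (v : W → M.carrier) :
    s.realize v = t.realize v := by
  refine realize_eq_of_mem_modEquiv_ofClass hM ∅ s t ?_ v (by simp)
  rintro N ⟨N', k, -, hk, hinj, -⟩ w -
  refine hinj _ _ fun b => ?_
  rw [(hk b).realize, (hk b).realize, h]

/-- With `e` fixed, `merge S b` retains only component `b` of its first argument; `e` is treated as
a fresh variable. -/
theorem merge_congr {M : LogicalMatrix (prodLanguage S)} (hM : M ∈ (prodLogic S).ModEquiv)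
    {b : Bool} {W : Type*} [Finite W] (s t : (prodLanguage S).Term W)
    (h : (proj S b).onTerm s = (proj S b).onTerm t) (v : W → M.carrier) (e : M.carrier) :
    funMap (merge S b) ![s.realize v, e] = funMap (merge S b) ![t.realize v, e] := by
  let m (r : (prodLanguage S).Term W) : (prodLanguage S).Term (Option W) :=
    Term.func (merge S b) ![r.relabel some, Term.var none]
  have hm : ∀ (A : Type u) [(prodLanguage S).Structure A] (r) (w : Option W → A),
      (m r).realize w = funMap (merge S b) ![r.realize (w ∘ some), w none] := by
    intro A _ r w
    simp only [m, Term.realize_func]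
    congr 1
    funext i
    fin_cases i
    · exact Term.realize_relabel
    · rfl
  have := realize_eq_of_mem_modEquiv_ofClass hM ∅ (m s) (m t) ?_ (fun o => o.elim e v) (by simp)
  · rwa [hm, hm] at this
  · rintro N ⟨N', k, -, hk, hinj, -⟩ w -
    refine hinj _ _ fun c => ?_
    rw [hm, hm, (hk c).funMap_merge, (hk c).funMap_merge]
    split_ifs with hc
    · subst hc
      rw [(hk c).realize, (hk c).realize, h]
    · rfl

theorem merge_mem {A : Type u} [Nonempty A] [(prodLanguage S).Structure A] {G : Set A}
    (hG : (prodLogic S).IsFilter G) (b : Bool) {x y : A} (hx : x ∈ G) (hy : y ∈ G) :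
    funMap (merge S b) ![x, y] ∈ G := by
  have hr : ∀ (A : Type u) [(prodLanguage S).Structure A] (w : Fin 2 → A),
      (Term.func (merge S b) Term.var : (prodLanguage S).Term (Fin 2)).realize w =
        funMap (merge S b) ![w 0, w 1] := by
    intro A _ w
    simp only [Term.realize_func, Term.realize_var]
    congr 1
    funext i
    fin_cases i <;> rfl
  have := mem_of_isFilter_ofClass_of_finite' hG ![x, y] {Term.var 0, Term.var 1}
    (Term.func (merge S b) Term.var) ?_ ?_
  · rwa [hr] at this
  · rintro N ⟨N', k, -, hk, -, hF⟩ w hw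
    rw [hr, hF]
    intro c
    rw [(hk c).funMap_merge]
    split_ifs
    · exact (hF _).1 (hw (Term.var 0) (by simp)) c
    · exact (hF _).1 (hw (Term.var 1) (by simp)) c
  · rintro _ (rfl | rfl)
    · exact hx
    · exact hy

end

/-! ### Splitting the reduced models of a product -/

section

variable {S : Bool → Logic.{u}} {M : LogicalMatrix (prodLanguage S)}

theorem merge_self (hM : M ∈ (prodLogic S).ModEquiv) (b : Bool) (e : M.carrier) :
    funMap (merge S b) ![e, e] = e := by
  have := realize_eq_of_proj hM (Term.func (merge S b) ![Term.var 0, Term.var 0])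
    (Term.var (0 : Fin 1)) (fun c => by
      simp only [Translation.onTerm, Term.substFunc, proj, merge]
      split_ifs <;> rfl) ![e]
  refine Eq.trans ?_ this
  simp only [Term.realize_func]
  congr 1
  funext i
  fin_cases i <;> rfl

theorem merge_merge_self (hM : M ∈ (prodLogic S).ModEquiv) (b : Bool) (a e : M.carrier) :
    funMap (merge S b) ![funMap (merge S b) ![a, e], e] = funMap (merge S b) ![a, e] := by
  have := merge_congr hM (b := b) (Term.func (merge S b) Term.var) (Term.var (0 : Fin 2))
    (by simp only [Translation.onTerm, Term.substFunc, proj, merge, if_true]; rfl) ![a, e] e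
  exact this

theorem merge_merge_of_ne (hM : M ∈ (prodLogic S).ModEquiv) {b c : Bool} (h : c ≠ b)
    (a e : M.carrier) : funMap (merge S c) ![funMap (merge S b) ![a, e], e] = e := by
  have := merge_congr hM (b := c) (Term.func (merge S b) Term.var) (Term.var (1 : Fin 2))
    (by simp only [Translation.onTerm, Term.substFunc, proj, merge, if_neg h]; rfl) ![a, e] e
  exact this.trans (merge_self hM c e)

theorem merge_true_false (hM : M ∈ (prodLogic S).ModEquiv) (a e : M.carrier) :
    funMap (merge S true) ![funMap (merge S true) ![a, e], funMap (merge S false) ![a, e]] = a := by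
  have := realize_eq_of_proj hM (Term.func (merge S true)
    ![Term.func (merge S true) Term.var, Term.func (merge S false) Term.var])
    (Term.var (0 : Fin 2)) (fun c => by
      cases c
      all_goals
        simp only [Translation.onTerm, Term.substFunc, proj, merge]
        rfl) ![a, e]
  refine Eq.trans ?_ this
  simp only [Term.realize_func]
  congr 1
  funext i
  fin_cases i <;> rfl

theorem merge_funMap_congr (hM : M ∈ (prodLogic S).ModEquiv) (b : Bool) (e : M.carrier) {n : ℕ}
    (F : (prodLanguage S).Functions n) (v : Fin n → M.carrier) :
    funMap (merge S b) ![funMap F fun i => funMap (merge S b) ![v i, e], e] =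
      funMap (merge S b) ![funMap F v, e] := by
  have := merge_congr hM (b := b) (W := Option (Fin n))
    (Term.func F fun i => Term.func (merge S b) ![Term.var (some i), Term.var none])
    (Term.func F fun i => Term.var (some i))
    (by simp only [Translation.onTerm, Term.substFunc, proj, merge, if_true]; rfl)
    (fun o => o.elim e v) e
  refine Eq.trans ?_ this
  simp only [Term.realize_func]
  congr 3
  funext i
  congr 1
  funext j
  fin_cases j <;> rfl

/-- The factor of index `b` of a reduced model of the product, as the set of fixed points of the
map that resets the other component to that of `e`. -/
def factor (hM : M ∈ (prodLogic S).ModEquiv) (e : M.carrier) (b : Bool) :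
    LogicalMatrix (S b).lang where
  carrier := {a : M.carrier // funMap (merge S b) ![a, e] = a}
  nonempty := ⟨⟨e, merge_self hM b e⟩⟩
  str :=
    { funMap := fun f v =>
        ⟨funMap (merge S b) ![funMap (liftSymbol b f) fun i => (v i).1, e],
          merge_merge_self hM b _ e⟩ }
  filter := {a | a.1 ∈ M.filter}

/-- The projection to a factor. -/
def toFactor (hM : M ∈ (prodLogic S).ModEquiv) (e : M.carrier) (b : Bool) (a : M.carrier) :
    (factor hM e b).carrier :=
  ⟨funMap (merge S b) ![a, e], merge_merge_self hM b a e⟩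

theorem toFactor_coe (hM : M ∈ (prodLogic S).ModEquiv) (e : M.carrier) (b : Bool)
    (x : (factor hM e b).carrier) : toFactor hM e b x.1 = x :=
  Subtype.ext x.2

theorem realize_toFactor (hM : M ∈ (prodLogic S).ModEquiv) (e : M.carrier) (b : Bool) {W : Type*}
    (t : (S b).lang.Term W) (v : W → M.carrier) :
    t.realize (toFactor hM e b ∘ v) = toFactor hM e b (((lift S b).onTerm t).realize v) := by
  induction t with
  | var x => rfl
  | func f ts ih =>
    have h : ((lift S b).onTerm (Term.func f ts)).realize v =
        funMap (liftSymbol b f) fun i => ((lift S b).onTerm (ts i)).realize v := by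
      simp only [Translation.onTerm, Term.substFunc, lift, Term.realize_subst, Term.realize_func,
        Term.realize_var]
    rw [h]
    refine Eq.trans (b := funMap (M := (factor hM e b).carrier) f fun i =>
      toFactor hM e b (((lift S b).onTerm (ts i)).realize v)) ?_
      (Subtype.ext (merge_funMap_congr hM b e (liftSymbol b f) fun i =>
        ((lift S b).onTerm (ts i)).realize v))
    exact congrArg (fun w => funMap (M := (factor hM e b).carrier) f w) (funext ih)

theorem isProj_toFactor (hM : M ∈ (prodLogic S).ModEquiv) (e : M.carrier) (b : Bool) :
    IsProj (S := S) (b := b) (toFactor hM e b) := by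
  intro n F v
  rw [realize_toFactor]
  exact Subtype.ext (merge_congr hM (Term.func F Term.var) _ (by
    rw [proj_lift]
    simp only [Translation.onTerm, Term.substFunc, proj]
    generalize F b = t
    induction t with
    | var x => rfl
    | func f ts ih => exact congrArg (Term.func f) (funext ih)) v e)

theorem toFactor_mem (hM : M ∈ (prodLogic S).ModEquiv) {G : Set M.carrier}
    (hG : (prodLogic S).IsFilter G) {e : M.carrier} (he : e ∈ G) (a : M.carrier) :
    a ∈ G ↔ ∀ b, (toFactor hM e b a).1 ∈ G := by
  refine ⟨fun ha b => merge_mem hG b ha he, fun h => ?_⟩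
  rw [← merge_true_false hM a e]
  exact merge_mem hG true (h true) (h false)

/-- A rule of `S b` becomes a rule of the product by merging each of its formulas with a fresh
variable and adding that variable as a premise: the other component is then designated. The fresh
variable is evaluated at `e`. -/
theorem isFilter_factor (hM : M ∈ (prodLogic S).ModEquiv) {G : Set M.carrier}
    (hG : (prodLogic S).IsFilter G) {e : M.carrier} (he : e ∈ G) (b : Bool) :
    (S b).IsFilter {a : (factor hM e b).carrier | a.1 ∈ G} := by
  intro Γ φ hφ v hv
  let w : (S b).Var → M.carrier := fun x => (v x).1
  have hw : v = toFactor hM e b ∘ w := funext fun x => (toFactor_coe hM e b _).symm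
  let m (r : (S b).lang.Term (S b).Var) : (prodLanguage S).Term (Option (S b).Var) :=
    Term.func (merge S b) ![((lift S b).onTerm r).relabel some, Term.var none]
  have hm : ∀ (A : Type u) [(prodLanguage S).Structure A] (r) (w : Option (S b).Var → A),
      (m r).realize w =
        funMap (merge S b) ![((lift S b).onTerm r).realize (w ∘ some), w none] := by
    intro A _ r w
    simp only [m, Term.realize_func]
    congr 1
    funext i
    fin_cases i
    · exact Term.realize_relabel
    · rfl
  have hmw : ∀ r, (m r).realize (fun o => o.elim e w) = (r.realize v).1 := by
    intro r
    rw [hm, hw, realize_toFactor]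
    rfl
  have hinj : Function.Injective fun o : Option (S b).Var =>
    (⟨b, o⟩ : Σ b, Option (S b).Var) :=
    sigma_mk_injective (β := fun b => Option (S b).Var)
  change (φ.realize v).1 ∈ G
  rw [← hmw]
  refine mem_of_isFilter_ofClass hG (U := Set.univ) _
    ⟨_, Function.extend (fun o => ⟨b, o⟩) (fun o => o.elim e w) fun _ => e,
      fun x _ => hinj.extend_apply _ _ x⟩ (insert (Term.var none) (m '' Γ)) (m φ) ?_ ?_ ?_ ?_
  · intro ψ _ A _ v w h
    rw [show v = w from funext fun x => h (Set.mem_univ x)]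
  · intro A _ v w h
    rw [show v = w from funext fun x => h (Set.mem_univ x)]
  · rintro N ⟨N', k, hN, hk, -, hF⟩ w hw
    rw [hm, hF]
    intro c
    rw [(hk c).funMap_merge]
    split_ifs with hc
    · subst hc
      rw [(hk c).realize, proj_lift]
      refine hN c Γ φ hφ _ fun ψ hψ => ?_
      have := (hF _).1 (hw _ (Set.mem_insert_of_mem _ ⟨ψ, hψ, rfl⟩)) c
      rwa [hm, (hk c).funMap_merge, if_pos rfl, (hk c).realize, proj_lift] at this
    · exact (hF _).1 (hw _ (Set.mem_insert _ _)) c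
  · rintro _ (rfl | ⟨ψ, hψ, rfl⟩)
    · exact he
    · rw [hmw]
      exact hv ψ hψ

/-- A filter of `M` restricts to the factor, and a compatible congruence of the factor extends to
`M` by acting on component `b` and as equality on the other. So Suszko congruent elements of the
factor are Suszko congruent in `M`. -/
theorem factor_mem_modEquiv (hM : M ∈ (prodLogic S).ModEquiv) {e : M.carrier} (he : e ∈ M.filter)
    (b : Bool) : factor hM e b ∈ (S b).ModEquiv := by
  refine ⟨isFilter_factor hM hM.1 he b, fun x y hxy => Subtype.ext (hM.2 x.1 y.1 ?_)⟩
  intro G hG hMG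
  obtain ⟨θ, hθ, hc, hθxy⟩ := hxy _ (isFilter_factor hM hG (hMG he) b) fun a ha => hMG ha
  let r : M.carrier → M.carrier → Prop := fun p q =>
    θ (toFactor hM e b p) (toFactor hM e b q) ∧
      ∀ c, c ≠ b → toFactor hM e c p = toFactor hM e c q
  have hr : Equivalence r :=
    ⟨fun p => ⟨θ.refl _, fun _ _ => rfl⟩, fun h => ⟨θ.symm h.1, fun c hc => (h.2 c hc).symm⟩,
      fun h h' => ⟨θ.trans h.1 h'.1, fun c hc => (h.2 c hc).trans (h'.2 c hc)⟩⟩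
  refine ⟨⟨r, hr⟩, fun n F v w h => ⟨?_, fun c hcb => ?_⟩, fun p q h hp => ?_,
    ⟨by rwa [toFactor_coe, toFactor_coe], fun c hcb => ?_⟩⟩
  · rw [isProj_toFactor hM e b n F, isProj_toFactor hM e b n F]
    exact hθ.realize _ fun i => (h i).1
  · rw [isProj_toFactor hM e c n F, isProj_toFactor hM e c n F]
    congr 1
    funext i
    exact (h i).2 c hcb
  · rw [toFactor_mem hM hG (hMG he)] at hp ⊢
    intro c
    by_cases hcb : c = b
    · subst hcb
      exact hc _ _ h.1 (hp c)
    · rw [← h.2 c hcb]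
      exact hp c
  · refine Subtype.ext ?_
    -- Elements of factor `b` share their other component with `e`.
    have key : ∀ z : (factor hM e b).carrier, (toFactor hM e c z.1).1 = e := fun z => by
      conv_lhs => rw [← toFactor_coe hM e b z]
      exact merge_merge_of_ne hM hcb z.1 e
    rw [key, key]

theorem prodLogic_mem_thrms (hS : ∀ b, S b ∈ Thrms) : prodLogic S ∈ Thrms := by
  choose t ht using fun b => exists_term_of_mem_thrms (hS b)
  let T : (prodLanguage S).Functions 1 := t
  refine mem_thrms_of_forall (S := prodLogic S) (Term.func T Term.var) fun M hM a => ?_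
  refine mem_of_isFilter_ofClass_of_finite' hM.1 (fun _ : Fin 1 => a) ∅ (Term.func T Term.var) ?_
    (by simp)
  rintro N ⟨N', k, hN, hk, -, hF⟩ w -
  rw [hF]
  intro b
  rw [Term.realize_func, hk b]
  convert ht b (N' b) (hN b) (k b (w 0)) using 2
  funext i
  fin_cases i
  rfl

/-- A reduced model of the product of two logics with theorems is a product of reduced models. -/
theorem exists_factors (hS : ∀ b, S b ∈ Thrms) (hM : M ∈ (prodLogic S).ModEquiv) :
    ∃ (N : ∀ b, LogicalMatrix (S b).lang) (h : ∀ b, M.carrier → (N b).carrier),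
      (∀ b, N b ∈ (S b).ModEquiv) ∧ (∀ b, IsProj (S := S) (b := b) (h b)) ∧
      (∀ b, Function.Surjective (h b)) ∧ (∀ x y, (∀ b, h b x = h b y) → x = y) ∧
      ∀ x, x ∈ M.filter ↔ ∀ b, h b x ∈ (N b).filter := by
  obtain ⟨t, ht⟩ := exists_term_of_mem_thrms (prodLogic_mem_thrms hS)
  have he := ht M hM.1 (Classical.arbitrary _)
  set e : M.carrier := t.realize fun _ => Classical.arbitrary M.carrier
  refine ⟨factor hM e, toFactor hM e, factor_mem_modEquiv hM he, isProj_toFactor hM e,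
    fun b x => ⟨x.1, toFactor_coe hM e b x⟩, fun x y h => ?_, toFactor_mem hM hM.1 he⟩
  rw [← merge_true_false hM x e, ← merge_true_false hM y e]
  exact congrArg₂ (fun p q => funMap (merge S true) ![p, q])
    (congrArg Subtype.val (h true)) (congrArg Subtype.val (h false))

end

/-! ### Products are greatest lower bounds -/

/-- The matrix with one element, which is designated. -/
def trivialMatrix (L : FirstOrder.Language.{u, 0}) : LogicalMatrix L where
  carrier := PUnit
  str := { funMap := fun _ _ => PUnit.unit, RelMap := fun _ _ => False }
  filter := Set.univ

/-- The trivial matrix fills the other component. -/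
theorem mem_mod_prodLogic_of_isFilter {S : Bool → Logic.{u}} {b : Bool}
    (M : LogicalMatrix (S b).lang) {G : Set M.carrier} (hG : (S b).IsFilter G) :
    (⟨(M.translate (proj S b)).carrier, G⟩ : LogicalMatrix (prodLanguage S)) ∈
      (prodLogic S).Mod := by
  apply isFilter_ofClass_of_mem
  have : ∀ c, ∃ (N : LogicalMatrix (S c).lang) (h : (M.translate (proj S b)).carrier → N.carrier),
      N ∈ (S c).Mod ∧ IsProj (S := S) (b := c) h ∧
      (c = b → Function.Injective h ∧ ∀ x, x ∈ G ↔ h x ∈ N.filter) ∧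
      (c ≠ b → ∀ x, h x ∈ N.filter) := by
    intro c
    by_cases hc : c = b
    · subst hc
      exact ⟨⟨M.carrier, G⟩, id, hG, fun n F v => rfl,
        fun _ => ⟨Function.injective_id, fun _ => Iff.rfl⟩, fun h => absurd rfl h⟩
    · exact ⟨trivialMatrix _, fun _ => PUnit.unit, fun _ _ _ _ _ => Set.mem_univ _,
        fun n F v => rfl, fun h => absurd h hc, fun _ _ => Set.mem_univ _⟩
  choose N h hN hh hb hc using this
  refine ⟨N, h, hN, hh, fun x y hxy => (hb b rfl).1 (hxy b), fun x => ?_⟩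
  refine ⟨fun hx c => ?_, fun hx => ((hb b rfl).2 x).2 (hx b)⟩
  by_cases hcb : c = b
  · exact ((hb c hcb).2 x).1 hx
  · exact hc c hcb x

theorem prodLogic_interpretable (S : Bool → Logic.{u}) (b : Bool) :
    (prodLogic S).Interpretable (S b) := by
  refine ⟨proj S b, fun M hM => ⟨mem_mod_prodLogic_of_isFilter M hM.1, fun x y hxy => ?_⟩⟩
  refine hM.2 x y fun G hG hMG => ?_
  obtain ⟨θ, hθ, hc, h⟩ := hxy G (mem_mod_prodLogic_of_isFilter M hG) hMG
  refine ⟨θ, fun n f v w hvw => ?_, hc, h⟩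
  have key : ∀ v : Fin n → M.carrier,
      funMap (M := (M.translate (proj S b)).carrier) (liftSymbol b f) v = funMap f v := by
    intro v
    change (liftSymbol b f b).realize v = _
    rw [liftSymbol_self]
    rfl
  have := hθ n (liftSymbol b f) v w hvw
  rwa [key v, key w] at this

/-- The two translations are paired. Filters of `T` on a factor pull back to the product, and
Leibniz congruences push forward along the surjective projections, so Suszko congruent elements
agree in both components. -/
theorem interpretable_prodLogic {T : Logic.{u}} {S : Bool → Logic.{u}} (hS : ∀ b, S b ∈ Thrms)
    (h : ∀ b, T.Interpretable (S b)) : T.Interpretable (prodLogic S) := by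
  choose τ hτ using h
  let σ : Translation T.lang (prodLanguage S) := fun n f =>
    Term.func (l := n) (fun b => τ b n f) Term.var
  refine ⟨σ, fun M hM => ?_⟩
  obtain ⟨N, h, hN, hh, hs, hinj, hF⟩ := exists_factors hS hM
  let h' (b : Bool) : (M.translate σ).carrier → ((N b).translate (τ b)).carrier := h b
  have hh' : ∀ b, IsHom T.lang (h' b) := fun b n f v => hh b n (fun b => τ b n f) v
  have hN' := fun b => hτ b (N b) (hN b)
  refine ⟨fun Γ φ hφ v hv => (hF _).2 fun b => ?_, fun x y hxy => hinj x y fun b => ?_⟩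
  · have := (hN' b).1.preimage (hh' b) Γ φ hφ v fun ψ hψ => (hF _).1 (hv ψ hψ) b
    exact this
  · refine (hN' b).2 (h' b x) (h' b y) fun G hG hNG => ?_
    exact (hxy (h' b ⁻¹' G) (hG.preimage (hh' b)) fun a ha => hNG ((hF a).1 ha b)).map
      (hh' b) (hs b)

/-- The supremum of two Leibniz classes of logics with theorems. -/
theorem exists_isLUB_pair (K : Bool → LeibnizClass.{u}) (hK : ∀ b, (K b : Set Logic.{u}) ⊆ Thrms) :
    ∃ J : LeibnizClass.{u}, IsLUB {K true, K false} J ∧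
      ∀ S ∈ (J : Set Logic.{u}), ∃ R : Bool → Logic.{u},
        (∀ b, R b ∈ (K b : Set Logic.{u})) ∧ (prodLogic R).Interpretable S := by
  choose Φ hmono hΦ using fun b => (K b).2
  have hmem : ∀ b α, Φ b α ∈ (K b : Set Logic.{u}) := fun b α => by
    rw [hΦ b]
    exact ⟨α, Logic.Interpretable.refl _⟩
  let Θ : Ordinal.{u} → Logic.{u} := fun α => prodLogic fun b => Φ b α
  have hΘ : ∀ α β, α ≤ β → (Θ β).Interpretable (Θ α) := fun α β h =>
    interpretable_prodLogic (fun b => hK b (hmem b α)) fun b =>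
      (prodLogic_interpretable (fun b => Φ b β) b).trans (hmono b α β h)
  refine ⟨⟨{S | ∃ α, (Θ α).Interpretable S}, Θ, hΘ, rfl⟩, ⟨?_, ?_⟩, ?_⟩
  · have : ∀ b, (K b : Set Logic.{u}) ⊆ {S | ∃ α, (Θ α).Interpretable S} := by
      intro b S hS
      rw [hΦ b] at hS
      obtain ⟨α, hα⟩ := hS
      exact ⟨α, (prodLogic_interpretable (fun b => Φ b α) b).trans hα⟩
    rintro _ (rfl | rfl)
    · exact this true
    · exact this false
  · rintro ⟨X, Ψ, hΨ, rfl⟩ hX S ⟨α, hα⟩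
    have hle : ∀ b, (K b : Set Logic.{u}) ⊆ {S | ∃ α, (Ψ α).Interpretable S} := by
      rintro (_ | _)
      · exact hX (Or.inr rfl)
      · exact hX (Or.inl rfl)
    -- Both factors lie above some `Ψ`; its value at the larger of the two indices lies below both,
    -- hence below their product.
    choose β hβ using fun b => hle b (hmem b α)
    refine ⟨max (β true) (β false), (interpretable_prodLogic (fun b => hK b (hmem b α))
      fun b => ?_).trans hα⟩
    refine (hΨ (β b) _ ?_).trans (hβ b)
    cases b
    · exact le_max_right _ _
    · exact le_max_left _ _
  · rintro S ⟨α, hα⟩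
    exact ⟨fun b => Φ b α, fun b => hmem b α, hα⟩

/-! ### The intersection of the two suprema -/

/-- The operation of the product with the given components. -/
def pairOp {S : Bool → Logic.{u}} {n : ℕ} (s : (S true).lang.Term (Fin n))
    (t : (S false).lang.Term (Fin n)) : (prodLanguage S).Functions n
  | true => s
  | false => t

theorem vec_two_const {A : Type*} (a b : A) : (![a, b] ∘ fun _ : Fin 1 => (0 : Fin 2)) = ![a] := by
  funext i
  fin_cases i
  rfl

theorem vec_one_const {A : Type*} (a : A) : (![a] ∘ fun _ : Fin 2 => (0 : Fin 1)) = ![a, a] := by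
  funext i
  fin_cases i <;> rfl

/-- Put `E = ⟨δ(x,y), φ(x)⟩` and `c = ⟨δ₀(x,x), φ(x)⟩`. Since `φ` is a theorem, `E` tests equality
of the first components, while equal values of `c` give equal second components by injectivity. -/
theorem exists_terms_of_equivl_injctv {R : Bool → Logic.{u}} (h₁ : R true ∈ Equivl)
    (h₂ : R false ∈ Injctv) (hR : ∀ b, R b ∈ Thrms) {S : Logic.{u}}
    (hS : (prodLogic R).Interpretable S) :
    ∃ (E : Set (S.lang.Term (Fin 2))) (c : S.lang.Term (Fin 1)), E.Nonempty ∧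
      ∀ M ∈ S.ModEquiv, (∀ a : M.carrier, c.realize ![a] ∈ M.filter) ∧
        ∀ a b : M.carrier, ((∀ δ ∈ E, δ.realize ![a, b] ∈ M.filter) ∧
          c.realize ![a] = c.realize ![b]) ↔ a = b := by
  obtain ⟨τ, hτ⟩ := hS
  obtain ⟨Δ, ⟨δ₀, hδ₀⟩, hΔ⟩ := mem_equivl_iff.1 h₁
  obtain ⟨φ, hφ⟩ := mem_injctv_iff.1 h₂
  let p (δ : (R true).lang.Term (Fin 2)) : (prodLanguage R).Term (Fin 2) :=
    Term.func (pairOp δ (φ.relabel fun _ => 0)) Term.var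
  let c : (prodLanguage R).Term (Fin 1) :=
    Term.func (pairOp (δ₀.relabel fun _ => 0) φ) Term.var
  have key : ∀ M ∈ (prodLogic R).ModEquiv, (∀ a : M.carrier, c.realize ![a] ∈ M.filter) ∧
      ∀ a b : M.carrier, ((∀ δ ∈ Δ, (p δ).realize ![a, b] ∈ M.filter) ∧
        c.realize ![a] = c.realize ![b]) ↔ a = b := by
    intro M hM
    obtain ⟨N, h, hN, hh, -, hinj, hF⟩ := exists_factors hR hM
    have hp₁ : ∀ δ a b, h true ((p δ).realize ![a, b]) = δ.realize ![h true a, h true b] :=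
      fun δ a b => (hh true 2 _ _).trans (by
        rw [← comp_vec_two]
        rfl)
    have hp₂ : ∀ δ a b, h false ((p δ).realize ![a, b]) = φ.realize ![h false a] :=
      fun δ a b => (hh false 2 _ _).trans (Term.realize_relabel.trans (by
        rw [← vec_two_const (h false a) (h false b), ← comp_vec_two]
        rfl))
    have hc₁ : ∀ a, h true (c.realize ![a]) = δ₀.realize ![h true a, h true a] :=
      fun a => (hh true 1 _ _).trans (Term.realize_relabel.trans (by
        rw [← vec_one_const, ← comp_vec_one]
        rfl))
    have hc₂ : ∀ a, h false (c.realize ![a]) = φ.realize ![h false a] :=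
      fun a => (hh false 1 _ _).trans (by
        rw [← comp_vec_one]
        rfl)
    refine ⟨fun a => (hF _).2 ?_, fun a b => ⟨?_, ?_⟩⟩
    · rintro (_ | _)
      · rw [hc₂]
        exact (hφ _ (hN false)).1 _
      · rw [hc₁]
        exact (hΔ _ (hN true) _ _).2 rfl _ hδ₀
    · rintro ⟨hE, hc⟩
      refine hinj _ _ ?_
      rintro (_ | _)
      · refine (hφ _ (hN false)).2 ?_
        have := congrArg (h false) hc
        rwa [hc₂, hc₂] at this
      · refine (hΔ _ (hN true) _ _).1 fun δ hδ => ?_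
        rw [← hp₁]
        exact (hF _).1 (hE δ hδ) true
    · rintro rfl
      refine ⟨fun δ hδ => (hF _).2 ?_, rfl⟩
      rintro (_ | _)
      · rw [hp₂]
        exact (hφ _ (hN false)).1 _
      · rw [hp₁]
        exact (hΔ _ (hN true) _ _).2 rfl δ hδ
  refine ⟨(fun δ => τ.onTerm (p δ)) '' Δ, τ.onTerm c, ⟨_, ⟨δ₀, hδ₀, rfl⟩⟩, fun M hM => ?_⟩
  simp only [Set.forall_mem_image, realize_onTerm]
  exact key _ (hτ M hM)

/-- Designated elements already agree in the assertional component. Filling that component with a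
theorem lets `E` test the equivalential one. -/
theorem exists_terms_of_equivl_asrt {R : Bool → Logic.{u}} (h₁ : R true ∈ Equivl)
    (h₂ : R false ∈ Asrt) (hR : ∀ b, R b ∈ Thrms) {S : Logic.{u}}
    (hS : (prodLogic R).Interpretable S) :
    ∃ E : Set (S.lang.Term (Fin 2)), ∀ M ∈ S.ModEquiv,
      (∀ a : M.carrier, ∀ δ ∈ E, δ.realize ![a, a] ∈ M.filter) ∧
        ∀ a b : M.carrier, a ∈ M.filter → b ∈ M.filter →
          (∀ δ ∈ E, δ.realize ![a, b] ∈ M.filter) → a = b := by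
  obtain ⟨τ, hτ⟩ := hS
  obtain ⟨Δ, -, hΔ⟩ := mem_equivl_iff.1 h₁
  obtain ⟨t, ht⟩ := exists_term_of_mem_thrms (hR false)
  let p (δ : (R true).lang.Term (Fin 2)) : (prodLanguage R).Term (Fin 2) :=
    Term.func (pairOp δ (t.relabel fun _ => 0)) Term.var
  have key : ∀ M ∈ (prodLogic R).ModEquiv,
      (∀ a : M.carrier, ∀ δ ∈ Δ, (p δ).realize ![a, a] ∈ M.filter) ∧
        ∀ a b : M.carrier, a ∈ M.filter → b ∈ M.filter →
          (∀ δ ∈ Δ, (p δ).realize ![a, b] ∈ M.filter) → a = b := by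
    intro M hM
    obtain ⟨N, h, hN, hh, -, hinj, hF⟩ := exists_factors hR hM
    have hp₁ : ∀ δ a b, h true ((p δ).realize ![a, b]) = δ.realize ![h true a, h true b] :=
      fun δ a b => (hh true 2 _ _).trans (by
        rw [← comp_vec_two]
        rfl)
    have hp₂ : ∀ δ a b, h false ((p δ).realize ![a, b]) = t.realize fun _ => h false a :=
      fun δ a b => (hh false 2 _ _).trans (Term.realize_relabel.trans rfl)
    refine ⟨fun a δ hδ => (hF _).2 ?_, fun a b ha hb hE => hinj _ _ ?_⟩
    · rintro (_ | _)
      · rw [hp₂]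
        exact ht _ (hN false).1 _
      · rw [hp₁]
        exact (hΔ _ (hN true) _ _).2 rfl δ hδ
    · rintro (_ | _)
      · obtain ⟨d, hd⟩ := h₂ _ (hN false)
        have ha' := (hF _).1 ha false
        have hb' := (hF _).1 hb false
        rw [hd] at ha' hb'
        exact ha'.trans hb'.symm
      · refine (hΔ _ (hN true) _ _).1 fun δ hδ => ?_
        rw [← hp₁]
        exact (hF _).1 (hE δ hδ) true
  refine ⟨(fun δ => τ.onTerm (p δ)) '' Δ, fun M hM => ?_⟩
  simp only [Set.forall_mem_image, realize_onTerm]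
  exact key _ (hτ M hM)

/-- Values of `c` are designated, so the equation `c(a) = c(b)` can be expressed by `E'(c(a),c(b))`;
together with `E(a,b)` it defines equality. -/
theorem equivl_of_prodLogic_interpretable {R R' : Bool → Logic.{u}} (h₁ : R true ∈ Equivl)
    (h₂ : R false ∈ Injctv) (hR : ∀ b, R b ∈ Thrms) (h₁' : R' true ∈ Equivl)
    (h₂' : R' false ∈ Asrt) (hR' : ∀ b, R' b ∈ Thrms) {S : Logic.{u}}
    (hS : (prodLogic R).Interpretable S) (hS' : (prodLogic R').Interpretable S) :
    S ∈ Equivl := by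
  obtain ⟨E, c, hne, h⟩ := exists_terms_of_equivl_injctv h₁ h₂ hR hS
  obtain ⟨E', h'⟩ := exists_terms_of_equivl_asrt h₁' h₂' hR' hS'
  let p (δ : S.lang.Term (Fin 2)) : S.lang.Term (Fin 2) :=
    δ.subst ![c.relabel fun _ => 0, c.relabel fun _ => 1]
  have hp : ∀ (M : LogicalMatrix S.lang) (a b : M.carrier) δ,
      (p δ).realize ![a, b] = δ.realize ![c.realize ![a], c.realize ![b]] := by
    intro M a b δ
    rw [Term.realize_subst]
    congr 1
    funext i
    fin_cases i <;>
    · refine Term.realize_relabel.trans (congrArg (fun w => c.realize w) ?_)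
      funext j
      fin_cases j
      rfl
  refine mem_equivl_iff.2 ⟨E ∪ p '' E', hne.inl, fun M hM a b => ?_⟩
  obtain ⟨hc, hE⟩ := h M hM
  obtain ⟨hrefl, hE'⟩ := h' M hM
  constructor
  · intro hab
    refine (hE a b).1 ⟨fun δ hδ => hab δ (Or.inl hδ), hE' _ _ (hc a) (hc b) fun δ hδ => ?_⟩
    rw [← hp]
    exact hab _ (Or.inr ⟨δ, hδ, rfl⟩)
  · rintro rfl δ (hδ | ⟨δ, hδ, rfl⟩)
    · exact ((hE a a).2 rfl).1 δ hδ
    · rw [hp]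
      exact hrefl _ δ hδ

/-! ### Protoalgebraic logics that are not equivalential -/

/-- Without parameters, congruence formulas take corresponding values in `N` and `M`, so Leibniz
congruent elements of `N` would stay congruent in `M`. -/
theorem not_equivl_of_isHom {S : Logic.{u}} {M N : LogicalMatrix S.lang} (hM : M ∈ S.Mod)
    {k : N.carrier → M.carrier} (hk : IsHom S.lang k) (hF : N.filter = k ⁻¹' M.filter)
    {x y : N.carrier} (hxy : LeibnizCongr S.lang N.filter x y)
    (hne : ¬LeibnizCongr S.lang M.filter (k x) (k y)) : S ∉ Equivl := by
  rintro ⟨Δ, -, hΔ⟩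
  have hN : N ∈ S.Mod := by
    change S.IsFilter N.filter
    rw [hF]
    exact Logic.IsFilter.preimage hk hM
  refine hne ((hΔ M hM _ _).2 fun δ hδ => ?_)
  have := (hΔ N hN x y).1 hxy δ hδ
  rwa [hF, Set.mem_preimage, hk.realize, comp_vec_two] at this

/-! ### Test matrices for the two counterexamples -/

open Classical in
/-- A two-valued implication. -/
noncomputable def twoValued {A : Type u} (F : Set A) (t f x y : A) : A :=
  if x ∈ F ∧ y ∉ F then f else t

theorem twoValued_mem_iff {A : Type u} {F : Set A} {t f : A} (ht : t ∈ F) (hf : f ∉ F) (x y : A) :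
    twoValued F t f x y ∈ F ↔ (x ∈ F → y ∈ F) := by
  unfold twoValued
  split_ifs with h <;> simp_all

theorem twoValued_congr {A : Type u} {F : Set A} {t f x y x' y' : A} (hx : x ∈ F ↔ x' ∈ F)
    (hy : y ∈ F ↔ y' ∈ F) : twoValued F t f x y = twoValued F t f x' y' := by
  classical exact if_congr (and_congr hx (not_congr hy)) rfl rfl

theorem map_twoValued {A B : Type u} (k : A → B) (G : Set B) (t f x y : A) :
    k (twoValued (k ⁻¹' G) t f x y) = twoValued G (k t) (k f) (k x) (k y) := by
  classical exact apply_ite k _ _ _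

/-- The algebra with the unary operation `φ`, and whose other operations apply to their first two
arguments a two-valued implication, the operation `g`, or the map `ψ` of the first argument. -/
noncomputable def testMatrix {A : Type u} (F : Set A) (t f : A) (φ ψ : A → A) (g : A → A → A) :
    LogicalMatrix (implLanguage (ULift.{u} (Fin 3))) where
  carrier := A
  nonempty := ⟨t⟩
  str :=
    { funMap := fun {n} =>
        match n with
        | 0 => fun s _ => PEmpty.elim s
        | 1 => fun _ v => φ (v 0)
        | _ + 2 => fun (i : ULift.{u} (Fin 3)) v =>
            ![twoValued F t f, g, fun x _ => ψ x] i.down (v 0) (v 1) }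
  filter := F

theorem testMatrix_isHom {A B : Type u} {F : Set A} {t f : A} {φ ψ : A → A} {g : A → A → A}
    {G : Set B} {t' f' : B} {φ' ψ' : B → B} {g' : B → B → B} {k : A → B} (hF : F = k ⁻¹' G)
    (ht : k t = t') (hf : k f = f') (hφ : ∀ x, k (φ x) = φ' (k x)) (hψ : ∀ x, k (ψ x) = ψ' (k x))
    (hg : ∀ x y, k (g x y) = g' (k x) (k y)) :
    IsHom (implLanguage (ULift.{u} (Fin 3))) (A := (testMatrix F t f φ ψ g).carrier)
      (B := (testMatrix G t' f' φ' ψ' g').carrier) k := by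
  subst hF ht hf
  rintro (_ | _ | n) s v
  · exact PEmpty.elim s
  · exact hφ _
  · obtain ⟨i⟩ := (s : ULift.{u} (Fin 3))
    fin_cases i
    · exact map_twoValued k G t f _ _
    · exact hg _ _
    · exact hψ _

theorem testMatrix_isCongruence {A : Type u} {F : Set A} {t f : A} {φ ψ : A → A} {g : A → A → A}
    (θ : Setoid A) (hF : Compatible θ F) (hφ : ∀ x y, θ x y → θ (φ x) (φ y))
    (hψ : ∀ x y, θ x y → θ (ψ x) (ψ y))
    (hg : ∀ x y x' y', θ x x' → θ y y' → θ (g x y) (g x' y')) :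
    IsCongruence (implLanguage (ULift.{u} (Fin 3))) (A := (testMatrix F t f φ ψ g).carrier) θ := by
  rintro (_ | _ | n) s v w h
  · exact PEmpty.elim s
  · exact hφ _ _ (h 0)
  · obtain ⟨i⟩ := (s : ULift.{u} (Fin 3))
    fin_cases i
    · have e : ∀ j, v j ∈ F ↔ w j ∈ F := fun j => ⟨hF _ _ (h j), hF _ _ (θ.symm (h j))⟩
      change θ (twoValued F t f (v 0) (v 1)) (twoValued F t f (w 0) (w 1))
      exact twoValued_congr (e 0) (e 1) ▸ θ.refl _
    · exact hg _ _ _ _ (h 0) (h 1)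
    · exact hψ _ _ (h 0)

theorem not_leibnizCongr_testMatrix {A : Type u} {F : Set A} {t f : A} {φ ψ : A → A}
    {g : A → A → A} {x y z : A} (hx : g x z ∈ F) (hy : g y z ∉ F) :
    ¬LeibnizCongr (implLanguage (ULift.{u} (Fin 3)))
      (A := (testMatrix F t f φ ψ g).carrier) F x y := by
  intro h
  have := LeibnizCongr.realize (A := (testMatrix F t f φ ψ g).carrier)
    (implTerm (⟨1⟩ : ULift.{u} (Fin 3))) (v := ![x, z]) (w := ![y, z]) fun j => by
      fin_cases j
      · exact h
      · exact LeibnizCongr.refl (A := (testMatrix F t f φ ψ g).carrier) F z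
  rw [realize_implTerm, realize_implTerm] at this
  exact hy (this.mem_iff.1 hx)

theorem testMatrix_proto {A : Type u} {F : Set A} {t f : A} {φ ψ : A → A} {g : A → A → A}
    (ht : t ∈ F) (hf : f ∉ F) :
    implLogic (ULift.{u} (Fin 3)) {testMatrix F t f φ ψ g} ∈ Proto := by
  refine mem_proto_of_forall {implTerm ⟨0⟩} (Set.singleton_nonempty _) ?_ ?_
  · rintro M hM a _ rfl
    have := mem_of_isFilter_ofClass_of_finite' hM ![a] ∅ ((implTerm ⟨0⟩).relabel fun _ => 0) ?_
      (by simp)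
    · rwa [Term.realize_relabel, vec_one_const] at this
    · rintro N rfl w -
      rw [Term.realize_relabel, realize_implTerm]
      exact (twoValued_mem_iff ht hf _ _).2 id
  · intro M hM a b ha h
    refine mem_of_isFilter_ofClass_of_finite' hM ![a, b] {Term.var 0, implTerm ⟨0⟩} (Term.var 1)
      ?_ ?_
    · rintro N rfl w hw
      have h₀ : w 0 ∈ F := hw (Term.var 0) (by simp)
      have h₁ := hw (implTerm ⟨0⟩) (by simp)
      rw [realize_implTerm] at h₁
      exact (twoValued_mem_iff ht hf (w 0) (w 1)).1 h₁ h₀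
    · rintro _ (rfl | rfl)
      · exact ha
      · exact h (implTerm ⟨0⟩) rfl

theorem exists_proto_asrt_not_equivl : ∃ S : Logic.{u}, S ∈ Proto ∧ S ∈ Asrt ∧ S ∉ Equivl := by
  classical
  -- `B` consists of a designated `none` and of `x`, `y`; `A` adds the parameter `some none`. In `A`
  -- only `g` separates `x` from `y`, and only at that parameter; in `B` it is constant.
  let B := Option (ULift.{u} Bool)
  let A := Option (Option (ULift.{u} Bool))
  let x : B := some ⟨false⟩
  let y : B := some ⟨true⟩
  let k : B → A := Option.map some
  let M := testMatrix (A := A) {none} none (k x) id id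
    fun a b => if a = k x ∧ b = some none then none else k x
  let N := testMatrix (A := B) {none} none x id id fun _ _ => x
  have hP := testMatrix_proto (A := A) (F := {none}) (t := none) (f := k x) (φ := id) (ψ := id)
    (g := fun a b => if a = k x ∧ b = some none then none else k x) rfl (by simp [k, x])
  have hkc : ∀ b, k b ≠ some none := by rintro (_ | _) h <;> cases h
  have hF : ({none} : Set B) = k ⁻¹' {none} := by
    ext b
    cases b <;> simp [k]
  refine ⟨implLogic _ {M}, hP, fun M' hM' => ?_, ?_⟩
  · obtain ⟨t, ht⟩ := exists_term_of_mem_thrms (proto_subset_thrms hP)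
    refine Set.exists_eq_singleton_iff_nonempty_subsingleton.2
      ⟨⟨_, ht M' hM'.1 (Classical.arbitrary _)⟩, fun a ha b hb => ?_⟩
    refine realize_eq_of_mem_modEquiv_ofClass hM' {Term.var 0, Term.var 1} (Term.var 0)
      (Term.var 1) ?_ ![a, b] ?_
    · rintro _ rfl w hw
      have h₀ : w 0 = none := hw (Term.var 0) (by simp)
      have h₁ : w 1 = none := hw (Term.var 1) (by simp)
      exact h₀.trans h₁.symm
    · rintro _ (rfl | rfl)
      · exact ha
      · exact hb
  · refine not_equivl_of_isHom (S := implLogic _ {M}) (M := M) (N := N) (k := k) (x := x) (y := y)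
      (isFilter_ofClass_of_mem rfl) ?_ hF ?_ ?_
    · refine testMatrix_isHom hF rfl rfl (fun _ => rfl) (fun _ => rfl) fun a b => ?_
      rw [if_neg fun h => hkc b h.2]
    · let θ : Setoid B := Setoid.ker Option.isSome
      have hθ : Compatible θ {none} := by
        intro a b h h'
        have h : a.isSome = b.isSome := h
        have h' : a = none := h'
        subst h'
        exact Option.isSome_eq_false_iff.1 h.symm |> Option.isNone_iff_eq_none.1
      exact ⟨θ, testMatrix_isCongruence θ hθ (fun _ _ h => h) (fun _ _ h => h)
        fun _ _ _ _ _ _ => θ.refl _, hθ, rfl⟩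
    · refine not_leibnizCongr_testMatrix (z := some none) ?_ ?_
      · exact if_pos ⟨rfl, rfl⟩
      · rw [if_neg fun h => ?_]
        · exact Option.some_ne_none _
        · cases h.1

theorem exists_proto_injctv_not_equivl :
    ∃ S : Logic.{u}, S ∈ Proto ∧ S ∈ Injctv ∧ S ∉ Equivl := by
  classical
  -- The parameter is now `(none, 0)`. The factor `ℕ` makes the successor an injective theorem: its
  -- values have non-zero second coordinate, hence are designated.
  let B := ULift.{u} Bool × ℕ
  let A := Option (ULift.{u} Bool) × ℕ
  let x : B := (⟨false⟩, 0)
  let y : B := (⟨true⟩, 0)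
  let k : B → A := Prod.map some id
  let FA : Set A := {a | a.2 ≠ 0}
  let FB : Set B := {a | a.2 ≠ 0}
  let gA : A → A → A := fun a b => if a = k x ∧ b = (none, 0) then (some ⟨false⟩, 1) else k x
  let φA : A → A := Prod.map id Nat.succ
  let ψA : A → A := Prod.map id Nat.pred
  let M := testMatrix FA (some ⟨false⟩, 1) (k x) φA ψA gA
  let N := testMatrix FB (⟨false⟩, 1) x (Prod.map id Nat.succ) (Prod.map id Nat.pred) fun _ _ => x
  have hP := testMatrix_proto (F := FA) (t := (some ⟨false⟩, 1)) (f := k x) (φ := φA) (ψ := ψA)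
    (g := gA) (by simp [FA]) (by simp [FA, k, x])
  refine ⟨implLogic _ {M}, hP, ?_, ?_⟩
  · let φ : (implLanguage (ULift.{u} (Fin 3))).Term (Fin 1) := Term.func (unary _) Term.var
    refine mem_injctv_iff.2 ⟨φ, fun M' hM' => ⟨fun a => ?_, ?_⟩⟩
    · refine mem_of_isFilter_ofClass_of_finite' hM'.1 ![a] ∅ φ ?_ (by simp)
      rintro _ rfl w -
      exact Nat.succ_ne_zero _
    -- The predecessor is a left inverse of the successor, an identity that passes to all reduced
    -- models and forces injectivity there.
    · have key : ∀ a : M'.carrier,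
          funMap (impl 0 (⟨2⟩ : ULift.{u} (Fin 3))) ![φ.realize ![a], φ.realize ![a]] = a := by
        intro a
        have := realize_eq_of_mem_modEquiv_ofClass hM' ∅
          ((implTerm (⟨2⟩ : ULift.{u} (Fin 3))).subst fun _ => φ) (Term.var 0) ?_ ![a] (by simp)
        · rw [Term.realize_subst, realize_implTerm] at this
          exact this
        · rintro _ rfl w -
          rw [Term.realize_subst, realize_implTerm]
          rfl
      intro a b hab
      rw [← key a, ← key b]
      exact congrArg (fun c => funMap (impl 0 (⟨2⟩ : ULift.{u} (Fin 3))) ![c, c]) hab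
  · refine not_equivl_of_isHom (S := implLogic _ {M}) (M := M) (N := N) (k := k) (x := x) (y := y)
      (isFilter_ofClass_of_mem rfl) ?_ rfl ?_ ?_
    · refine testMatrix_isHom rfl rfl rfl (fun _ => rfl) (fun _ => rfl) fun a b => ?_
      have : ¬(k a = k x ∧ k b = (none, 0)) := fun h =>
        Option.some_ne_none b.1 (congrArg Prod.fst h.2)
      exact (if_neg this).symm
    · let θ : Setoid B := Setoid.ker Prod.snd
      have hθ : Compatible θ FB := fun a b h ha => by
        have h : a.2 = b.2 := h
        change b.2 ≠ 0
        rw [← h]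
        exact ha
      exact ⟨θ, testMatrix_isCongruence θ hθ (fun _ _ h => congrArg Nat.succ h)
        (fun _ _ h => congrArg Nat.pred h) fun _ _ _ _ _ _ => θ.refl _, hθ, rfl⟩
    · refine not_leibnizCongr_testMatrix (z := (none, 0)) ?_ ?_
      · change gA (k x) (none, 0) ∈ FA
        rw [show gA (k x) (none, 0) = (some ⟨false⟩, 1) from if_pos ⟨rfl, rfl⟩]
        exact one_ne_zero
      · change gA (k y) (none, 0) ∉ FA
        rw [show gA (k y) (none, 0) = k x from if_neg fun h => by cases h.1]
        exact fun h => h rfl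

end AAL

/-! ### Assembly of the theorem -/

theorem theorem6p12 :
    ∃ E PI PA J₁ J₂ : AAL.LeibnizClass.{u},
      (E : Set AAL.Logic.{u}) = AAL.Equivl ∧
      (PI : Set AAL.Logic.{u}) = AAL.Proto ∩ AAL.Injctv ∧
      (PA : Set AAL.Logic.{u}) = AAL.Proto ∩ AAL.Asrt ∧
      IsLUB {E, PI} J₁ ∧ IsLUB {E, PA} J₂ ∧
      AAL.MeetReducibleAmongThrms E ∧
      (E : Set AAL.Logic.{u}) = (J₁ : Set AAL.Logic.{u}) ∩ (J₂ : Set AAL.Logic.{u}) := by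
  open AAL in
  let E : LeibnizClass.{u} := ⟨Equivl, isLeibnizClass_equivl⟩
  let PI : LeibnizClass.{u} := ⟨Proto ∩ Injctv, isLeibnizClass_proto_inter_injctv⟩
  let PA : LeibnizClass.{u} := ⟨Proto ∩ Asrt, isLeibnizClass_proto_inter_asrt⟩
  have hPI : ∀ b, ((bif b then E else PI : LeibnizClass.{u}) : Set Logic.{u}) ⊆ Thrms := by
    rintro (_ | _)
    · exact fun S hS => proto_subset_thrms hS.1
    · exact equivl_subset_thrms
  have hPA : ∀ b, ((bif b then E else PA : LeibnizClass.{u}) : Set Logic.{u}) ⊆ Thrms := by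
    rintro (_ | _)
    · exact fun S hS => proto_subset_thrms hS.1
    · exact equivl_subset_thrms
  obtain ⟨J₁, hJ₁, h₁⟩ := exists_isLUB_pair (fun b => bif b then E else PI) hPI
  obtain ⟨J₂, hJ₂, h₂⟩ := exists_isLUB_pair (fun b => bif b then E else PA) hPA
  replace hJ₁ : IsLUB {E, PI} J₁ := hJ₁
  replace hJ₂ : IsLUB {E, PA} J₂ := hJ₂
  have hE₁ : E ≤ J₁ := hJ₁.1 (Set.mem_insert _ _)
  have hE₂ : E ≤ J₂ := hJ₂.1 (Set.mem_insert _ _)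
  have hle₁ : PI ≤ J₁ := hJ₁.1 (Set.mem_insert_of_mem _ rfl)
  have hle₂ : PA ≤ J₂ := hJ₂.1 (Set.mem_insert_of_mem _ rfl)
  have hinter : (E : Set Logic.{u}) = (J₁ : Set Logic.{u}) ∩ (J₂ : Set Logic.{u}) := by
    refine Set.Subset.antisymm (fun S hS => ⟨hE₁ hS, hE₂ hS⟩) ?_
    rintro S ⟨hS₁, hS₂⟩
    obtain ⟨R, hR, hRS⟩ := h₁ S hS₁
    obtain ⟨R', hR', hRS'⟩ := h₂ S hS₂
    exact equivl_of_prodLogic_interpretable (hR true) (hR false).2 (fun b => hPI b (hR b))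
      (hR' true) (hR' false).2 (fun b => hPA b (hR' b)) hRS hRS'
  refine ⟨E, PI, PA, J₁, J₂, rfl, rfl, rfl, hJ₁, hJ₂, ⟨J₁, J₂, ?_, ?_, hinter, ?_, ?_⟩, hinter⟩
  · intro S hS
    obtain ⟨R, hR, hRS⟩ := h₁ S hS
    exact thrms_of_interpretable (prodLogic_mem_thrms fun b => hPI b (hR b)) hRS
  · intro S hS
    obtain ⟨R, hR, hRS⟩ := h₂ S hS
    exact thrms_of_interpretable (prodLogic_mem_thrms fun b => hPA b (hR b)) hRS
  · intro h
    obtain ⟨S, hP, hI, hE⟩ := exists_proto_injctv_not_equivl.{u}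
    exact hE (h.ge (hle₁ ⟨hP, hI⟩))
  · intro h
    obtain ⟨S, hP, hA, hE⟩ := exists_proto_asrt_not_equivl.{u}
    exact hE (h.ge (hle₂ ⟨hP, hA⟩))
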